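/- Let $M$ be a smooth (Hausdorff) 4-dimensional Riemannian spin manifold, with orientation and spin structure fixed, and let $S_\pm$ be its two complex rank-two spinor bundles, so that $TM\otimes\mathbb C\cong S_+\otimes S_-$ and $S_+^2\cong\Lambda^+\otimes\mathbb C$. Write $S_\pm^k$ for the $k$-th symmetric power, use unprimed indices $A$ for $S_+$ and primed indices $A'$ for $S_-$, lower indices with the spinor metrics $\epsilon$, and let $\nabla^{AA'}$ be the Levi-Civita (spin) covariant derivative in spinor notation. On smooth sections define $$d:S_+^k\otimes S_-^n\to S_+^{k+1}\otimes S_-^{n+1},\qquad (d\psi)^{A_1\ldots A_{k+1}A_1'\ldots A_{n+1}'}=(k+1)(n+1)\,\nabla^{(A_{k+1}(A_{n+1}'}\psi^{A_1\ldots A_k)A_1'\ldots A_n')},$$ $$\delta:S_+^k\otimes S_-^n\to S_+^{k+1}\otimes S_-^{n-1}\ (n\ge1),\qquad (\delta\psi)^{A_1\ldots A_{k+1}A_1'\ldots A_{n-1}'}=(k+1)\,\nabla^{(A_{k+1}}{}_{A'}\psi^{A_1\ldots A_k)A_1'\ldots A_{n-1}'A'},$$ where the round brackets denote symmetrisation separately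 in the unprimed and in the primed indices, and put $\delta=0$ on $S_+^k$. Let $W^+$ be the self-dual part of the Weyl curvature, and call the metric Einstein if the Ricci tensor is at every point a multiple of the metric. Then: 1. $d\delta-\delta d=0$ on the sections of $S_+^k\otimes S_-^n$ for all $k,n\ge0$ if and only if $W^+=0$ and the metric is Einstein. Moreover, for each single pair $k,n\ge1$, $d\delta-\delta d=0$ on the sections of $S_+^k\otimes S_-^n$ if and only if $W^+=0$ and the metric is Einstein. 2. For each $k\ge1$, on $S_+^k$ the term $d\delta$ is absent, and $\delta d=0$ on the sections of $S_+^k$ if and only if $W^+=0$. 3. For each $n\ge1$, $d\delta-\delta d=0$ on the sections of $S_-^n$ if and only if the metric is Einstein. -/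

import Mathlib

open scoped Manifold ContDiff Bundle

noncomputable section

namespace SpinFour

/-- The model space `ℝ⁴`. -/
abbrev E4 : Type := EuclideanSpace ℝ (Fin 4)

/-! ### Levi-Civita connection and curvature of a Riemannian metric -/

section LeviCivita

variable {M : Type*} [TopologicalSpace M] [ChartedSpace E4 M] [IsManifold (𝓡 4) ∞ M]
  [Bundle.RiemannianBundle (fun x : M => TangentSpace (𝓡 4) x)]

instance finiteDimensional_tangentSpace (x : M) : FiniteDimensional ℝ (TangentSpace (𝓡 4) x) :=
  inferInstanceAs (FiniteDimensional ℝ E4)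

/-- The right-hand side of the Koszul formula for `⟨∇_X Y, Z⟩` at `x`. -/
def koszul (X Y Z : Π x : M, TangentSpace (𝓡 4) x) (x : M) : ℝ :=
  (1 / 2) *
    (mvfderiv (𝓡 4) (fun y => inner ℝ (Y y) (Z y)) x (X x)
      + mvfderiv (𝓡 4) (fun y => inner ℝ (X y) (Z y)) x (Y x)
      - mvfderiv (𝓡 4) (fun y => inner ℝ (X y) (Y y)) x (Z x)
      + inner ℝ (VectorField.mlieBracket (𝓡 4) X Y x) (Z x)
      - inner ℝ (VectorField.mlieBracket (𝓡 4) X Z x) (Y x)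
      - inner ℝ (VectorField.mlieBracket (𝓡 4) Y Z x) (X x))

/-- The Levi-Civita covariant derivative `∇_X Y` at `x`: the tangent vector whose inner products
with the vectors of an orthonormal basis of the tangent space at `x` are given by the Koszul
formula. The basis vectors are extended to vector fields that are smooth near `x`; the Koszul
expression depends on its last argument only through the value at `x`. -/
def leviCivita (X Y : Π x : M, TangentSpace (𝓡 4) x) (x : M) : TangentSpace (𝓡 4) x :=
  ∑ c, koszul X Y
      (FiberBundle.extend E4 (stdOrthonormalBasis ℝ (TangentSpace (𝓡 4) x) c)) x
    • stdOrthonormalBasis ℝ (TangentSpace (𝓡 4) x) c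

/-- `R(X, Y) Z = ∇_X ∇_Y Z - ∇_Y ∇_X Z - ∇_[X, Y] Z`. -/
def curvature (X Y Z : Π x : M, TangentSpace (𝓡 4) x) (x : M) : TangentSpace (𝓡 4) x :=
  leviCivita X (leviCivita Y Z) x - leviCivita Y (leviCivita X Z) x
    - leviCivita (VectorField.mlieBracket (𝓡 4) X Y) Z x

/-- Components `⟨R(e_a, e_b) e_c, e_d⟩` of the Riemann tensor in a frame `e`. -/
def riemann (e : Fin 4 → Π x : M, TangentSpace (𝓡 4) x) (x : M) (a b c d : Fin 4) : ℝ :=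
  inner ℝ (curvature (e a) (e b) (e c) x) (e d x)

/-- Components of the Ricci tensor, the trace of `X ↦ R(X, e_b) e_c`, in an orthonormal frame. -/
def ricci (e : Fin 4 → Π x : M, TangentSpace (𝓡 4) x) (x : M) (b c : Fin 4) : ℝ :=
  ∑ a, riemann e x a b c a

/-- The scalar curvature, computed in an orthonormal frame. -/
def scalar (e : Fin 4 → Π x : M, TangentSpace (𝓡 4) x) (x : M) : ℝ :=
  ∑ a, ricci e x a a

/-- Kronecker delta: the components of the metric in an orthonormal frame. -/
def kdelta (a b : Fin 4) : ℝ := if a = b then 1 else 0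

/-- Components of the Weyl tensor in an orthonormal frame (dimension four). -/
def weyl (e : Fin 4 → Π x : M, TangentSpace (𝓡 4) x) (x : M) (a b c d : Fin 4) : ℝ :=
  riemann e x a b c d
    - (1 / 2) * (ricci e x a d * kdelta b c + ricci e x b c * kdelta a d
        - ricci e x a c * kdelta b d - ricci e x b d * kdelta a c)
    + (scalar e x / 6) * (kdelta a d * kdelta b c - kdelta a c * kdelta b d)

/-- The totally antisymmetric symbol with `volSymbol 0 1 2 3 = 1`: the components of the volume
form in a positively oriented orthonormal frame. -/
def volSymbol (a b c d : Fin 4) : ℝ :=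
  ((Matrix.of fun i j : Fin 4 => if ![a, b, c, d] i = j then (1 : ℤ) else 0).det : ℤ)

/-- Components of the self-dual part `W⁺ = (W + ⋆W) / 2` of the Weyl tensor in a positively
oriented orthonormal frame. -/
def weylPlus (e : Fin 4 → Π x : M, TangentSpace (𝓡 4) x) (x : M) (a b c d : Fin 4) : ℝ :=
  (1 / 2) * (weyl e x a b c d
    + (1 / 2) * ∑ p, ∑ r, volSymbol a b p r * weyl e x p r c d)

end LeviCivita

/-! ### Spin structures

`Spin(4) = SU(2) × SU(2)`, and `ℝ⁴` is identified with the quaternions, realised as `2 × 2`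
complex matrices, so that `(a, b)` acts on `ℝ⁴` by `q ↦ a q b⁻¹`. The first factor acts on `S₊`
and the second one on `S₋`. With the orientation `1, i, j, k`, left multiplications by imaginary
quaternions correspond to self-dual two-forms, so `S₊²` is the bundle of self-dual two-forms. -/

/-- The unit quaternions `1, i, j, k` as complex matrices. -/
def quat : Fin 4 → Matrix (Fin 2) (Fin 2) ℂ :=
  ![1,
    !![Complex.I, 0; 0, -Complex.I],
    !![0, 1; -1, 0],
    !![0, Complex.I; Complex.I, 0]]

/-- The spinor metric `ε`. -/
def eps : Matrix (Fin 2) (Fin 2) ℂ := !![0, 1; -1, 0]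

/-- The isomorphism of `ℝ⁴ ⊗ ℂ` with `S₊ ⊗ S₋` on basis vectors: `σ_c` has components
`σ_c^{AA'} = (q_c ε)^{AA'}`. It intertwines `v ↦ a v b⁻¹` with `V ↦ a V bᵀ`. -/
def soldering (c : Fin 4) : Matrix (Fin 2) (Fin 2) ℂ := quat c * eps

/-- The double cover `Spin(4) → SO(4)`: the matrix of `q ↦ a q b⁻¹` in the basis `1, i, j, k`. -/
def spinCover (a b : Matrix.specialUnitaryGroup (Fin 2) ℂ) : Matrix (Fin 4) (Fin 4) ℝ :=
  Matrix.of fun c d =>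
    (1 / 2) * (Matrix.trace ((quat c).conjTranspose * (a : Matrix (Fin 2) (Fin 2) ℂ) * quat d
      * (b : Matrix (Fin 2) (Fin 2) ℂ).conjTranspose)).re

/-- A spin structure (with the underlying orientation) on a Riemannian four-manifold, given by
local trivialisations: an open cover with smooth orthonormal frames, declared to be positively
oriented, and a smooth `Spin(4)`-valued cocycle lifting the transition functions of the frames. -/
structure SpinStructure (M : Type*) [TopologicalSpace M] [ChartedSpace E4 M]
    [IsManifold (𝓡 4) ∞ M] [Bundle.RiemannianBundle (fun x : M => TangentSpace (𝓡 4) x)] where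
  /-- index set of the cover -/
  ι : Type*
  /-- the open cover -/
  U : ι → Set M
  isOpen_U : ∀ i, IsOpen (U i)
  cover : ∀ x, ∃ i, x ∈ U i
  /-- the local frames -/
  e : ι → Fin 4 → Π x : M, TangentSpace (𝓡 4) x
  smooth_e : ∀ i a, ContMDiffOn (𝓡 4) (𝓡 4).tangent ∞
    (fun x => (⟨x, e i a x⟩ : TangentBundle (𝓡 4) M)) (U i)
  orthonormal_e : ∀ i, ∀ x ∈ U i, ∀ a b, inner ℝ (e i a x) (e i b x) = kdelta a b
  /-- transition functions of `S₊` -/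
  tp : ι → ι → M → Matrix.specialUnitaryGroup (Fin 2) ℂ
  /-- transition functions of `S₋` -/
  tm : ι → ι → M → Matrix.specialUnitaryGroup (Fin 2) ℂ
  smooth_tp : ∀ i j A B, ContMDiffOn (𝓡 4) 𝓘(ℝ, ℂ) ∞
    (fun x => (tp i j x : Matrix (Fin 2) (Fin 2) ℂ) A B) (U i ∩ U j)
  smooth_tm : ∀ i j A B, ContMDiffOn (𝓡 4) 𝓘(ℝ, ℂ) ∞
    (fun x => (tm i j x : Matrix (Fin 2) (Fin 2) ℂ) A B) (U i ∩ U j)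
  cocycle_tp : ∀ i j l, ∀ x ∈ U i ∩ U j ∩ U l, tp i j x * tp j l x = tp i l x
  cocycle_tm : ∀ i j l, ∀ x ∈ U i ∩ U j ∩ U l, tm i j x * tm j l x = tm i l x
  frame_change : ∀ i j, ∀ x ∈ U i ∩ U j, ∀ d,
    e j d x = ∑ c, spinCover (tp i j x) (tm i j x) c d • e i c x

/-- Components `ψ^{A₁…A_k A'₁…A'_n}` with `k` unprimed and `n` primed indices. -/
abbrev SpinTensor (k n : ℕ) : Type := (Fin k → Fin 2) → (Fin n → Fin 2) → ℂ

section Spinors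

variable {M : Type*} [TopologicalSpace M] [ChartedSpace E4 M] [IsManifold (𝓡 4) ∞ M]
  [Bundle.RiemannianBundle (fun x : M => TangentSpace (𝓡 4) x)]

/-- A smooth section of `S₊^k ⊗ S₋^n` (symmetric powers): smooth component functions in each
local trivialisation, symmetric in the unprimed and in the primed indices, which transform with
the transition functions. -/
structure SpinorField (S : SpinStructure M) (k n : ℕ) where
  /-- the components in each trivialisation -/
  comp : S.ι → M → SpinTensor k n
  smooth : ∀ i A A', ContMDiffOn (𝓡 4) 𝓘(ℝ, ℂ) ∞ (fun x => comp i x A A') (S.U i)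
  symm : ∀ i, ∀ x ∈ S.U i, ∀ (s : Equiv.Perm (Fin k)) (t : Equiv.Perm (Fin n)) A A',
    comp i x (A ∘ s) (A' ∘ t) = comp i x A A'
  transition : ∀ i j, ∀ x ∈ S.U i ∩ S.U j, ∀ A A',
    comp i x A A' = ∑ B : Fin k → Fin 2, ∑ B' : Fin n → Fin 2,
      (∏ m, (S.tp i j x : Matrix (Fin 2) (Fin 2) ℂ) (A m) (B m))
        * (∏ m, (S.tm i j x : Matrix (Fin 2) (Fin 2) ℂ) (A' m) (B' m)) * comp j x B B'

namespace SpinStructure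

variable (S : SpinStructure M)

/-- The `𝔰𝔬(4)`-valued connection form of the Levi-Civita connection in the frame `e i`:
`connForm i c x a b = ⟨∇_{e_c} e_b, e_a⟩`. -/
def connForm (i : S.ι) (c : Fin 4) (x : M) (a b : Fin 4) : ℝ :=
  inner ℝ (leviCivita (S.e i c) (S.e i b) x) (S.e i a x)

/-- The component in the first factor of `𝔰𝔲(2) ⊕ 𝔰𝔲(2) = 𝔰𝔬(4)` of the connection form along
`e_c`. The matrix `Ω` in `𝔰𝔬(4)` corresponds to the pair `(α, β)` such that
`Ω` acts on quaternions as `q ↦ α q - q β`. -/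
def connPlus (i : S.ι) (c : Fin 4) (x : M) : Matrix (Fin 2) (Fin 2) ℂ :=
  (1 / 4 : ℂ) • ∑ a, ∑ b, (S.connForm i c x a b : ℂ) • (quat a * (quat b).conjTranspose)

/-- The component in the second factor of `𝔰𝔲(2) ⊕ 𝔰𝔲(2) = 𝔰𝔬(4)` of the connection form
along `e_c`. -/
def connMinus (i : S.ι) (c : Fin 4) (x : M) : Matrix (Fin 2) (Fin 2) ℂ :=
  (1 / 4 : ℂ) • ∑ a, ∑ b, (S.connForm i c x a b : ℂ) • ((quat a).conjTranspose * quat b)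

variable {S}
variable {k n : ℕ}

/-- The covariant derivative `∇_{e_c} φ` of a spinor field with components `φ` in the
trivialisation `i`, for the spin connection (the lift of the Levi-Civita connection). -/
def covDeriv (i : S.ι) (c : Fin 4) (φ : M → SpinTensor k n) (x : M) : SpinTensor k n :=
  fun A A' =>
    mvfderiv (𝓡 4) (fun y => φ y A A') x (S.e i c x)
      + ∑ m, ∑ B, S.connPlus i c x (A m) B * φ x (Function.update A m B) A'
      + ∑ m, ∑ B', S.connMinus i c x (A' m) B' * φ x A (Function.update A' m B')

/-- The operator `∇^{BB'} = ∑ σ_c^{BB'} ∇_{e_c}`. -/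
def nabla (i : S.ι) (B B' : Fin 2) (φ : M → SpinTensor k n) (x : M) : SpinTensor k n :=
  fun A A' => ∑ c, soldering c B B' * covDeriv i c φ x A A'

/-- The operator `d : S₊^k ⊗ S₋^n → S₊^(k+1) ⊗ S₋^(n+1)`,
`ψ ↦ (k+1)(n+1) ∇^{(A(A'} ψ^{…)…)}`, in the trivialisation `i`. As `ψ` is symmetric, `(k+1)(n+1)`
times the symmetrisation is the sum over the positions of the two indices of `∇`. -/
def dOp (i : S.ι) (φ : M → SpinTensor k n) (x : M) : SpinTensor (k + 1) (n + 1) :=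
  fun A A' => ∑ p : Fin (k + 1), ∑ r : Fin (n + 1),
    nabla i (A p) (A' r) φ x (fun m => A (p.succAbove m)) (fun m => A' (r.succAbove m))

/-- The operator `δ : S₊^k ⊗ S₋^(n+1) → S₊^(k+1) ⊗ S₋^n`,
`ψ ↦ (k+1) ∇^{(A}_{B'} ψ^{…)…B'}`, in the trivialisation `i`, where the primed index is lowered
with `ε`. As `ψ` is symmetric, `k+1` times the symmetrisation is the sum over the positions of
the unprimed index of `∇`. -/
def deltaOp (i : S.ι) (φ : M → SpinTensor k (n + 1)) (x : M) : SpinTensor (k + 1) n :=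
  fun A A' => ∑ p : Fin (k + 1), ∑ B', ∑ C',
    eps B' C' * nabla i (A p) B' φ x (fun m => A (p.succAbove m)) (Fin.snoc A' C')

variable (S)

/-- `dδ - δd` vanishes on sections of `S₊^k ⊗ S₋^n`. On `S₊^k` the operator `δ` is absent and the
condition is `δd = 0`. -/
def CommutesOn (k : ℕ) : ℕ → Prop
  | 0 => ∀ ψ : SpinorField S k 0, ∀ i, ∀ x ∈ S.U i, deltaOp i (dOp i (ψ.comp i)) x = 0
  | n + 1 => ∀ ψ : SpinorField S k (n + 1), ∀ i, ∀ x ∈ S.U i,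
      dOp i (deltaOp i (ψ.comp i)) x - deltaOp i (dOp i (ψ.comp i)) x = 0

/-- The self-dual part of the Weyl curvature vanishes. -/
def WeylPlusVanishes : Prop :=
  ∀ i, ∀ x ∈ S.U i, ∀ a b c d, weylPlus (S.e i) x a b c d = 0

/-- The metric is Einstein: at every point the Ricci tensor is a multiple of the metric. -/
def IsEinstein : Prop :=
  ∀ i, ∀ x ∈ S.U i, ∃ r : ℝ, ∀ a b, ricci (S.e i) x a b = r * kdelta a b

end SpinStructure

end Spinors

end SpinFour

end

/-!
The second covariant derivatives in `d δ ψ - δ d ψ` occur only antisymmetrised, so the difference is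
the action on `ψ` of the curvature of `S₊^k ⊗ S₋^n`, seen as a 2-form with values in
`End S₊ ⊕ End S₋` and projected to its self-dual part `S₊²`, with all `k + 2` unprimed indices
symmetrised. In the bases of `Λ⁺` and `Λ⁻` given by the imaginary quaternions its two components
are the blocks `Λ⁺ → Λ⁺` and `Λ⁺ → Λ⁻` of the curvature operator: the first is scalar iff `W⁺ = 0`,
the second vanishes iff the metric is Einstein.

A scalar block acts through a product of `ε`s and dies under the symmetrisation. Conversely,
evaluate on `ψ = ξ^k η^n` and contract with `κ^(k+2) κ'^n`: the square of the spinor `κ` runs over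
the null vectors of `ℂ³`, and a symmetric form that vanishes on all null vectors is scalar, while a
bilinear form that vanishes on all pairs of null vectors is zero.
-/

noncomputable section

namespace SpinFour

section DirectionalDerivatives

open VectorField

variable {E : Type*} [NormedAddCommGroup E] [NormedSpace ℝ E] {H : Type*} [TopologicalSpace H]
  {I : ModelWithCorners ℝ E H} {M : Type*} [TopologicalSpace M] [ChartedSpace H M]
  {F : Type*} [NormedAddCommGroup F] [NormedSpace ℝ F]
  {F' : Type*} [NormedAddCommGroup F'] [NormedSpace ℝ F']
  {U : Set M} {x : M}

lemma mdifferentiableAt_of_contMDiffOn {E' : Type*} [NormedAddCommGroup E'] [NormedSpace ℝ E']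
    {H' : Type*} [TopologicalSpace H'] {I' : ModelWithCorners ℝ E' H'} {M' : Type*}
    [TopologicalSpace M'] [ChartedSpace H' M'] {f : M → M'} (hU : IsOpen U)
    (hf : ContMDiffOn I I' ∞ f U) (hx : x ∈ U) : MDifferentiableAt I I' f x :=
  (hf.contMDiffAt (hU.mem_nhds hx)).mdifferentiableAt (by simp)

lemma mvfderiv_congr {f g : M → F} (h : f =ᶠ[nhds x] g) : mvfderiv I f x = mvfderiv I g x := by
  simp only [mvfderiv]
  rw [h.mfderiv_eq, h.eq_of_nhds]

lemma mvfderiv_clm_comp (L : F →L[ℝ] F') {f : M → F} (hf : MDiffAt f x) (v : TangentSpace I x) :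
    mvfderiv I (fun y => L (f y)) x v = L (mvfderiv I f x v) :=
  congr($((L.hasMFDerivAt.comp x hf.hasMFDerivAt).mfderiv) v)

variable [IsManifold I ∞ M] {X Y Z : Π x : M, TangentSpace I x} {f : M → F} {g : M → ℝ}

lemma contMDiffOn_mvfderiv_apply (hU : IsOpen U) (hf : CMDiff[U] ∞ f) (hX : CMDiff[U] ∞ (T% X)) :
    CMDiff[U] ∞ (fun y => mvfderiv I f y (X y)) := by
  have h := (contMDiff_snd_tangentBundle_modelSpace F 𝓘(ℝ, F) (n := ∞)).comp_contMDiffOn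
    ((hf.contMDiffOn_tangentMapWithin le_rfl hU.uniqueMDiffOn).comp hX fun y hy => hy)
  exact h.congr fun y hy => congr($(mfderivWithin_of_isOpen hU hy) (X y)).symm

variable [CompleteSpace E]

lemma contMDiffAt_mlieBracket (hX : CMDiffAt ∞ (T% X) x) (hY : CMDiffAt ∞ (T% Y) x) :
    CMDiffAt ∞ (T% (mlieBracket I X Y)) x := by
  have : IsManifold I (((⊤ : ℕ∞) : WithTop ℕ∞) + 1) M := ‹IsManifold I ∞ M›
  have : IsManifold I (minSmoothness ℝ 2) M := by
    rw [minSmoothness_of_isRCLikeNormedField]; infer_instance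
  exact ContMDiffAt.mlieBracket_vectorField (m := ⊤) (n := ⊤) hX hY (by simp)

lemma mlieBracket_jacobi (hX : CMDiffAt ∞ (T% X) x) (hY : CMDiffAt ∞ (T% Y) x)
    (hZ : CMDiffAt ∞ (T% Z) x) :
    mlieBracket I X (mlieBracket I Y Z) x =
      mlieBracket I (mlieBracket I X Y) Z x + mlieBracket I Y (mlieBracket I X Z) x := by
  have : IsManifold I (minSmoothness ℝ 3) M := by
    rw [minSmoothness_of_isRCLikeNormedField]; infer_instance
  have h2 : minSmoothness ℝ 2 ≤ ∞ := by
    rw [minSmoothness_of_isRCLikeNormedField]; exact ENat.LEInfty.out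
  exact leibniz_identity_mlieBracket_apply (hX.of_le h2) (hY.of_le h2) (hZ.of_le h2)

lemma mlieBracket_mlieBracket_smul (hU : IsOpen U) (hx : x ∈ U) (hY : CMDiff[U] ∞ (T% Y))
    (hg : CMDiff[U] ∞ g) (hZ : CMDiffAt ∞ (T% Z) x) :
    mlieBracket I X (mlieBracket I Y (g • Z)) x =
      mvfderiv I (fun y => mvfderiv I g y (Y y)) x (X x) • Z x
      + mvfderiv I g x (Y x) • mlieBracket I X Z x
      + (mvfderiv I g x (X x) • mlieBracket I Y Z x
      + g x • mlieBracket I X (mlieBracket I Y Z) x) := by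
  have hgx := mdifferentiableAt_of_contMDiffOn hU hg hx
  have hDg := mdifferentiableAt_of_contMDiffOn hU (contMDiffOn_mvfderiv_apply hU hg hY) hx
  have hZd : MDiffAt (T% Z) x := hZ.mdifferentiableAt (by simp)
  have hYZ : MDiffAt (T% (mlieBracket I Y Z)) x :=
    (contMDiffAt_mlieBracket (hY.contMDiffAt (hU.mem_nhds hx)) hZ).mdifferentiableAt (by simp)
  have hZ' := (contMDiffAt_iff_contMDiffAt_nhds (by simp)).1 (hZ.of_le (m := 1) ENat.LEInfty.out)
  have hYgZ : mlieBracket I Y (g • Z) =ᶠ[nhds x]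
      ((fun y => mvfderiv I g y (Y y)) • Z) + g • mlieBracket I Y Z := by
    filter_upwards [hU.mem_nhds hx, hZ'] with y hy hZy
    exact mlieBracket_smul_right (mdifferentiableAt_of_contMDiffOn hU hg hy)
      (hZy.mdifferentiableAt (by simp))
  rw [Filter.EventuallyEq.mlieBracket_vectorField_eq (.refl _ X) hYgZ,
    mlieBracket_add_right (hDg.smul_section hZd) (hgx.smul_section hYZ),
    mlieBracket_smul_right hDg hZd, mlieBracket_smul_right hgx hYZ]

-- Compare the coefficients of `Z` in the Jacobi identity for `X`, `Y` and `g • Z`.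
lemma mvfderiv_mvfderiv_sub_real (hU : IsOpen U) (hx : x ∈ U) (hX : CMDiff[U] ∞ (T% X))
    (hY : CMDiff[U] ∞ (T% Y)) (hg : CMDiff[U] ∞ g) :
    mvfderiv I (fun y => mvfderiv I g y (Y y)) x (X x)
      - mvfderiv I (fun y => mvfderiv I g y (X y)) x (Y x)
      = mvfderiv I g x (mlieBracket I X Y x) := by
  rcases subsingleton_or_nontrivial (TangentSpace I x) with _ | _
  · simp [Subsingleton.elim _ (0 : TangentSpace I x)]
  obtain ⟨v, hv⟩ := exists_ne (0 : TangentSpace I x)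
  let Z := FiberBundle.extend E v
  have hZ : CMDiffAt ∞ (T% Z) x := FiberBundle.contMDiffAt_extend I E v
  have hgx := hg.contMDiffAt (hU.mem_nhds hx)
  have hXx := hX.contMDiffAt (hU.mem_nhds hx)
  have hYx := hY.contMDiffAt (hU.mem_nhds hx)
  have jacobi := mlieBracket_jacobi hXx hYx (hgx.smul_section hZ)
  rw [mlieBracket_mlieBracket_smul hU hx hY hg hZ, mlieBracket_mlieBracket_smul hU hx hX hg hZ,
    mlieBracket_smul_right (hgx.mdifferentiableAt (by simp)) (hZ.mdifferentiableAt (by simp)),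
    mlieBracket_jacobi hXx hYx hZ] at jacobi
  have h : (mvfderiv I (fun y => mvfderiv I g y (Y y)) x (X x)
      - mvfderiv I (fun y => mvfderiv I g y (X y)) x (Y x)
      - mvfderiv I g x (mlieBracket I X Y x)) • Z x = 0 := by
    rw [← sub_eq_zero.2 jacobi]
    module
  have hZx : Z x ≠ 0 := by simpa [Z] using hv
  exact sub_eq_zero.1 ((smul_eq_zero.1 h).resolve_right hZx)

lemma mvfderiv_mvfderiv_sub (hU : IsOpen U) (hx : x ∈ U) (hX : CMDiff[U] ∞ (T% X))
    (hY : CMDiff[U] ∞ (T% Y)) (hf : CMDiff[U] ∞ f) :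
    mvfderiv I (fun y => mvfderiv I f y (Y y)) x (X x)
      - mvfderiv I (fun y => mvfderiv I f y (X y)) x (Y x)
      = mvfderiv I f x (mlieBracket I X Y x) := by
  refine (SeparatingDual.eq_iff_forall_dual_eq (R := ℝ)).2 fun L => ?_
  have hfd := fun y hy => mdifferentiableAt_of_contMDiffOn (x := y) hU hf hy
  have hL : ∀ {V W : Π x : M, TangentSpace I x}, CMDiff[U] ∞ (T% W) →
      L (mvfderiv I (fun y => mvfderiv I f y (W y)) x (V x)) =
        mvfderiv I (fun y => mvfderiv I (fun z => L (f z)) y (W y)) x (V x) := by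
    intro V W hW
    have hDf := mdifferentiableAt_of_contMDiffOn hU (contMDiffOn_mvfderiv_apply hU hf hW) hx
    rw [← mvfderiv_clm_comp L hDf]
    refine congr($(mvfderiv_congr ?_) (V x))
    filter_upwards [hU.mem_nhds hx] with y hy using (mvfderiv_clm_comp L (hfd y hy) _).symm
  rw [map_sub, hL hY, hL hX, ← mvfderiv_clm_comp L (hfd x hx)]
  exact mvfderiv_mvfderiv_sub_real hU hx hX hY (L.contMDiff.comp_contMDiffOn hf)

end DirectionalDerivatives

section RiemannianBundle

variable {EB : Type*} [NormedAddCommGroup EB] [NormedSpace ℝ EB] {HB : Type*} [TopologicalSpace HB]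
  {IB : ModelWithCorners ℝ EB HB} {B : Type*} [TopologicalSpace B] [ChartedSpace HB B]
  {F : Type*} [NormedAddCommGroup F] [NormedSpace ℝ F] {V : B → Type*}
  [TopologicalSpace (Bundle.TotalSpace F V)] [∀ x, NormedAddCommGroup (V x)]
  [∀ x, InnerProductSpace ℝ (V x)] [FiberBundle F V] [VectorBundle ℝ F V]
  [IsContMDiffRiemannianBundle IB 1 F V] {s s' t : Π x, V x} {f : B → ℝ} {x : B}

lemma mvfderiv_inner_smul_left (hf : MDiffAt f x) (hs : MDiffAt (T% s) x) (ht : MDiffAt (T% t) x)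
    (v : TangentSpace IB x) :
    mvfderiv IB (fun y => inner ℝ ((f • s) y) (t y)) x v =
      f x * mvfderiv IB (fun y => inner ℝ (s y) (t y)) x v
        + inner ℝ (s x) (t x) * mvfderiv IB f x v := by
  have h : (fun y => inner ℝ ((f • s) y) (t y)) = f * fun y => inner ℝ (s y) (t y) := by
    ext y
    exact real_inner_smul_left ..
  rw [h, mvfderiv_mul hf (hs.inner_bundle ht)]
  simp

lemma mvfderiv_inner_smul_right (hf : MDiffAt f x) (hs : MDiffAt (T% s) x)
    (ht : MDiffAt (T% t) x) (v : TangentSpace IB x) :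
    mvfderiv IB (fun y => inner ℝ (s y) ((f • t) y)) x v =
      f x * mvfderiv IB (fun y => inner ℝ (s y) (t y)) x v
        + inner ℝ (s x) (t x) * mvfderiv IB f x v := by
  simp only [real_inner_comm _ (s _)]
  exact mvfderiv_inner_smul_left hf ht hs v

lemma mvfderiv_inner_add_left (hs : MDiffAt (T% s) x) (hs' : MDiffAt (T% s') x)
    (ht : MDiffAt (T% t) x) (v : TangentSpace IB x) :
    mvfderiv IB (fun y => inner ℝ ((s + s') y) (t y)) x v =
      mvfderiv IB (fun y => inner ℝ (s y) (t y)) x v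
        + mvfderiv IB (fun y => inner ℝ (s' y) (t y)) x v := by
  have h : (fun y => inner ℝ ((s + s') y) (t y)) =
      (fun y => inner ℝ (s y) (t y)) + fun y => inner ℝ (s' y) (t y) := by
    ext y
    exact inner_add_left ..
  rw [h, mvfderiv_add (hs.inner_bundle ht) (hs'.inner_bundle ht)]
  rfl

lemma mvfderiv_inner_add_right (ht : MDiffAt (T% t) x) (hs : MDiffAt (T% s) x)
    (hs' : MDiffAt (T% s') x) (v : TangentSpace IB x) :
    mvfderiv IB (fun y => inner ℝ (t y) ((s + s') y)) x v =
      mvfderiv IB (fun y => inner ℝ (t y) (s y)) x v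
        + mvfderiv IB (fun y => inner ℝ (t y) (s' y)) x v := by
  simp only [real_inner_comm _ (t _)]
  exact mvfderiv_inner_add_left hs hs' ht v

end RiemannianBundle

section LeviCivitaConnection

open VectorField

variable {M : Type*} [TopologicalSpace M] [ChartedSpace E4 M]
  [Bundle.RiemannianBundle (fun x : M => TangentSpace (𝓡 4) x)]

lemma koszul_sub_koszul_swap_left (X Y Z : Π x : M, TangentSpace (𝓡 4) x) (x : M) :
    koszul X Y Z x - koszul Y X Z x = inner ℝ (mlieBracket (𝓡 4) X Y x) (Z x) := by
  simp only [koszul, mlieBracket_swap_apply (V := Y) (W := X), inner_neg_left,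
    real_inner_comm (X _) (Y _)]
  ring

lemma koszul_add_koszul_swap_right (X Y Z : Π x : M, TangentSpace (𝓡 4) x) (x : M) :
    koszul X Y Z x + koszul X Z Y x = mvfderiv (𝓡 4) (fun y => inner ℝ (Y y) (Z y)) x (X x) := by
  simp only [koszul, mlieBracket_swap_apply (V := Z) (W := Y), inner_neg_left,
    real_inner_comm (Y _) (Z _)]
  ring

variable [IsManifold (𝓡 4) ∞ M]

lemma leviCivita_sub_leviCivita (X Y : Π x : M, TangentSpace (𝓡 4) x) (x : M) :
    leviCivita X Y x - leviCivita Y X x = mlieBracket (𝓡 4) X Y x := by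
  rw [← (stdOrthonormalBasis ℝ (TangentSpace (𝓡 4) x)).sum_repr' (mlieBracket (𝓡 4) X Y x)]
  simp only [leviCivita, ← Finset.sum_sub_distrib, ← sub_smul, koszul_sub_koszul_swap_left,
    FiberBundle.extend_apply_self, real_inner_comm]

/-- Differentiability of a vector field at a point, as a section of the tangent bundle. -/
abbrev FieldDiffAt (X : Π x : M, TangentSpace (𝓡 4) x) (x : M) : Prop :=
  MDifferentiableAt (𝓡 4) (𝓡 4).tangent (T% X) x

/-- Smoothness of a vector field near a point, as a section of the tangent bundle. -/
abbrev FieldSmoothAt (X : Π x : M, TangentSpace (𝓡 4) x) (x : M) : Prop :=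
  ContMDiffAt (𝓡 4) (𝓡 4).tangent ∞ (T% X) x

variable [IsContMDiffRiemannianBundle (𝓡 4) ∞ E4 (fun x : M => TangentSpace (𝓡 4) x)]
  {X Y Y' Z : Π x : M, TangentSpace (𝓡 4) x} {x : M}

instance : IsContMDiffRiemannianBundle (𝓡 4) 1 E4 (fun x : M => TangentSpace (𝓡 4) x) :=
  .of_le (n := ∞) (by norm_cast)

lemma tensorialAt_koszul_last (hX : FieldDiffAt X x) (hY : FieldDiffAt Y x) :
    TensorialAt (𝓡 4) E4 (fun Z => koszul X Y Z x) x := by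
  constructor
  · intro f Z hf hZ
    simp only [koszul, mvfderiv_inner_smul_right hf hX hZ, mvfderiv_inner_smul_right hf hY hZ]
    simp only [mlieBracket_smul_right hf hZ, Pi.smul_apply', map_smul, real_inner_smul_left,
      real_inner_smul_right, inner_add_left, real_inner_comm (X x) (Z x),
      real_inner_comm (Y x) (Z x), smul_eq_mul]
    ring
  · intro Z Z' hZ hZ'
    simp only [koszul, mvfderiv_inner_add_right hX hZ hZ', mvfderiv_inner_add_right hY hZ hZ']
    simp only [mlieBracket_add_right hZ hZ', Pi.add_apply, map_add, inner_add_left, inner_add_right]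
    ring

lemma tensorialAt_koszul_first (hY : FieldDiffAt Y x) (hZ : FieldDiffAt Z x) :
    TensorialAt (𝓡 4) E4 (fun X => koszul X Y Z x) x := by
  constructor
  · intro f X hf hX
    simp only [koszul, mvfderiv_inner_smul_left hf hX hZ, mvfderiv_inner_smul_left hf hX hY]
    simp only [mlieBracket_smul_left hf hX, Pi.smul_apply', map_smul, real_inner_smul_left,
      real_inner_smul_right, inner_add_left, smul_eq_mul]
    ring
  · intro X X' hX hX'
    simp only [koszul, mvfderiv_inner_add_left hX hX' hZ, mvfderiv_inner_add_left hX hX' hY]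
    simp only [mlieBracket_add_left hX hX', Pi.add_apply, map_add, inner_add_left, inner_add_right]
    ring

lemma inner_leviCivita (hX : FieldDiffAt X x) (hY : FieldDiffAt Y x) (hZ : FieldDiffAt Z x) :
    inner ℝ (leviCivita X Y x) (Z x) = koszul X Y Z x := by
  have hK := tensorialAt_koszul_last hX hY
  rw [← hK.mkHom_apply hZ]
  conv_rhs => rw [← (stdOrthonormalBasis ℝ (TangentSpace (𝓡 4) x)).sum_repr' (Z x), map_sum]
  simp only [leviCivita, sum_inner, map_smul, real_inner_smul_left, smul_eq_mul,
    TensorialAt.mkHom_apply_eq_extend, mul_comm]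

lemma mvfderiv_inner (hX : FieldDiffAt X x) (hY : FieldDiffAt Y x) (hZ : FieldDiffAt Z x) :
    mvfderiv (𝓡 4) (fun y => inner ℝ (Y y) (Z y)) x (X x) =
      inner ℝ (leviCivita X Y x) (Z x) + inner ℝ (Y x) (leviCivita X Z x) := by
  rw [inner_leviCivita hX hY hZ, real_inner_comm, inner_leviCivita hX hZ hY,
    koszul_add_koszul_swap_right]

lemma leviCivita_add (hX : FieldDiffAt X x) (hY : FieldDiffAt Y x) (hY' : FieldDiffAt Y' x) :
    leviCivita X (Y + Y') x = leviCivita X Y x + leviCivita X Y' x := by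
  refine ext_inner_right ℝ fun v => ?_
  have hZ := FiberBundle.mdifferentiableAt_extend (𝓡 4) E4 v
  have h := mvfderiv_inner_add_left hY hY' hZ (X x)
  rw [mvfderiv_inner hX (mdifferentiableAt_add_section hY hY') hZ, mvfderiv_inner hX hY hZ,
    mvfderiv_inner hX hY' hZ, Pi.add_apply, FiberBundle.extend_apply_self, inner_add_left] at h
  rw [inner_add_left]
  linarith

lemma tensorialAt_leviCivita (hY : FieldDiffAt Y x) :
    TensorialAt (𝓡 4) E4 (fun X => leviCivita X Y x) x := by
  have hK := fun v => tensorialAt_koszul_first hY (FiberBundle.mdifferentiableAt_extend (𝓡 4) E4 v)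
  constructor
  · intro f X hf hX
    simp only [leviCivita, (hK _).smul hf hX, smul_eq_mul, mul_smul, Finset.smul_sum]
  · intro X X' hX hX'
    simp only [leviCivita, (hK _).add hX hX', add_smul, Finset.sum_add_distrib]

end LeviCivitaConnection

section OrthonormalFrames

open VectorField

variable {M : Type*} [TopologicalSpace M] [ChartedSpace E4 M] [IsManifold (𝓡 4) ∞ M]
  [Bundle.RiemannianBundle (fun x : M => TangentSpace (𝓡 4) x)]

/-- `e` is a smooth orthonormal frame on the open set `U`. -/
structure IsOrthonormalFrame (U : Set M) (e : Fin 4 → Π x : M, TangentSpace (𝓡 4) x) : Prop where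
  isOpen : IsOpen U
  smooth : ∀ a, ContMDiffOn (𝓡 4) (𝓡 4).tangent ∞ (T% (e a)) U
  orthonormal : ∀ x ∈ U, ∀ a b, inner ℝ (e a x) (e b x) = kdelta a b

/-- The connection coefficients `⟨∇_{e_c} e_b, e_a⟩` of a frame, with the index order of
`SpinStructure.connForm`. -/
def christoffel (e : Fin 4 → Π x : M, TangentSpace (𝓡 4) x) (c a b : Fin 4) (x : M) : ℝ :=
  inner ℝ (leviCivita (e c) (e b) x) (e a x)

lemma inner_mlieBracket_frame (e : Fin 4 → Π x : M, TangentSpace (𝓡 4) x) (a b c : Fin 4) (x : M) :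
    inner ℝ (mlieBracket (𝓡 4) (e a) (e b) x) (e c x) =
      christoffel e a c b x - christoffel e b c a x := by
  rw [← leviCivita_sub_leviCivita, inner_sub_left]
  rfl

namespace IsOrthonormalFrame

variable {U : Set M} {e : Fin 4 → Π x : M, TangentSpace (𝓡 4) x} {x : M}

lemma contMDiffAt (he : IsOrthonormalFrame U e) (hx : x ∈ U) (a : Fin 4) :
    FieldSmoothAt (e a) x :=
  (he.smooth a).contMDiffAt (he.isOpen.mem_nhds hx)

lemma mdifferentiableAt (he : IsOrthonormalFrame U e) (hx : x ∈ U) (a : Fin 4) :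
    FieldDiffAt (e a) x :=
  mdifferentiableAt_of_contMDiffOn he.isOpen (he.smooth a) hx

lemma sum_inner_smul (he : IsOrthonormalFrame U e) (hx : x ∈ U) (v : TangentSpace (𝓡 4) x) :
    ∑ a, inner ℝ v (e a x) • e a x = v := by
  have ho : Orthonormal ℝ (fun a => e a x) := orthonormal_iff_ite.2 (he.orthonormal x hx)
  have hc : Fintype.card (Fin 4) = Module.finrank ℝ (TangentSpace (𝓡 4) x) :=
    (Fintype.card_fin 4).trans finrank_euclideanSpace_fin.symm
  let b := (basisOfOrthonormalOfCardEqFinrank ho hc).toOrthonormalBasis (by simpa using ho)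
  have hb : ∀ a, b a = e a x := by simp [b]
  conv_rhs => rw [← b.sum_repr' v]
  simp only [hb, real_inner_comm]

lemma sum_inner_mul_inner (he : IsOrthonormalFrame U e) (hx : x ∈ U) (v w : TangentSpace (𝓡 4) x) :
    ∑ a, inner ℝ v (e a x) * inner ℝ w (e a x) = inner ℝ v w := by
  conv_rhs => rw [← he.sum_inner_smul hx v]
  simp only [sum_inner, real_inner_smul_left, real_inner_comm _ w]

lemma leviCivita_eq_sum (he : IsOrthonormalFrame U e) (hx : x ∈ U) (b c : Fin 4) :
    leviCivita (e b) (e c) x = ∑ d, christoffel e b d c x • e d x :=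
  (he.sum_inner_smul hx _).symm

lemma mlieBracket_eq_sum (he : IsOrthonormalFrame U e) (hx : x ∈ U) (a b : Fin 4) :
    mlieBracket (𝓡 4) (e a) (e b) x =
      ∑ c, (christoffel e a c b x - christoffel e b c a x) • e c x := by
  simp only [← inner_mlieBracket_frame, he.sum_inner_smul hx]

lemma mlieBracket_cyclic (he : IsOrthonormalFrame U e) (hx : x ∈ U) (a b c : Fin 4) :
    mlieBracket (𝓡 4) (e a) (mlieBracket (𝓡 4) (e b) (e c)) x
      + mlieBracket (𝓡 4) (e b) (mlieBracket (𝓡 4) (e c) (e a)) x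
      + mlieBracket (𝓡 4) (e c) (mlieBracket (𝓡 4) (e a) (e b)) x = 0 := by
  have hs := he.contMDiffAt hx
  have h : mlieBracket (𝓡 4) (e b) (mlieBracket (𝓡 4) (e a) (e c)) x
      = - mlieBracket (𝓡 4) (e b) (mlieBracket (𝓡 4) (e c) (e a)) x := by
    rw [mlieBracket_swap (V := e a) (W := e c), ← neg_one_smul ℝ (mlieBracket (𝓡 4) (e c) (e a)),
      mlieBracket_const_smul_right ((contMDiffAt_mlieBracket (hs c) (hs a)).mdifferentiableAt
        (by simp)), neg_one_smul]
  rw [mlieBracket_jacobi (hs a) (hs b) (hs c), h, mlieBracket_swap_apply (V := e c)]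
  abel

lemma mvfderiv_inner_eq_zero (he : IsOrthonormalFrame U e) (hx : x ∈ U) (a b : Fin 4) :
    mvfderiv (𝓡 4) (fun y => inner ℝ (e a y) (e b y)) x = 0 := by
  rw [mvfderiv_congr (g := fun _ => kdelta a b), mvfderiv_const]
  filter_upwards [he.isOpen.mem_nhds hx] with y hy using he.orthonormal y hy a b

variable [IsContMDiffRiemannianBundle (𝓡 4) ∞ E4 (fun x : M => TangentSpace (𝓡 4) x)]

lemma christoffel_eq (he : IsOrthonormalFrame U e) (hx : x ∈ U) (c a b : Fin 4) :
    christoffel e c a b x = (1 / 2) *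
      (inner ℝ (mlieBracket (𝓡 4) (e c) (e b) x) (e a x)
      - inner ℝ (mlieBracket (𝓡 4) (e c) (e a) x) (e b x)
      - inner ℝ (mlieBracket (𝓡 4) (e b) (e a) x) (e c x)) := by
  rw [christoffel, inner_leviCivita (he.mdifferentiableAt hx c) (he.mdifferentiableAt hx b)
    (he.mdifferentiableAt hx a)]
  simp [koszul, he.mvfderiv_inner_eq_zero hx]

lemma christoffel_skew (he : IsOrthonormalFrame U e) (hx : x ∈ U) (c a b : Fin 4) :
    christoffel e c a b x = -christoffel e c b a x := by
  have h := mvfderiv_inner (he.mdifferentiableAt hx c) (he.mdifferentiableAt hx b)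
    (he.mdifferentiableAt hx a)
  rw [he.mvfderiv_inner_eq_zero hx, real_inner_comm _ (e b x)] at h
  exact eq_neg_of_add_eq_zero_left h.symm

lemma contMDiffOn_christoffel (he : IsOrthonormalFrame U e) (c a b : Fin 4) :
    ContMDiffOn (𝓡 4) 𝓘(ℝ) ∞ (christoffel e c a b) U := by
  have hbracket : ∀ a b c : Fin 4,
      ContMDiffOn (𝓡 4) 𝓘(ℝ) ∞
        (fun y => inner ℝ (mlieBracket (𝓡 4) (e a) (e b) y) (e c y)) U := fun a b c =>
    ContMDiffOn.inner_bundle (F := E4) (E := fun x : M => TangentSpace (𝓡 4) x)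
      (fun y hy => (contMDiffAt_mlieBracket (he.contMDiffAt hy a)
        (he.contMDiffAt hy b)).contMDiffWithinAt) (he.smooth c)
  exact (contMDiffOn_const.mul (((hbracket c b a).sub (hbracket c a b)).sub
    (hbracket b a c))).congr fun y hy => he.christoffel_eq hy c a b

lemma contMDiffAt_leviCivita (he : IsOrthonormalFrame U e) (hx : x ∈ U) (b c : Fin 4) :
    FieldSmoothAt (leviCivita (e b) (e c)) x := by
  have h : FieldSmoothAt (fun y => ∑ d, (christoffel e b d c • e d) y) x :=
    .sum_section fun d _ => ((he.contMDiffOn_christoffel b d c).contMDiffAt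
      (he.isOpen.mem_nhds hx)).smul_section (he.contMDiffAt hx d)
  refine h.congr_of_eventuallyEq ?_
  filter_upwards [he.isOpen.mem_nhds hx] with y hy
  rw [he.leviCivita_eq_sum hy]
  rfl

lemma inner_leviCivita_leviCivita (he : IsOrthonormalFrame U e) (hx : x ∈ U) (a b c d : Fin 4) :
    inner ℝ (leviCivita (e a) (leviCivita (e b) (e c)) x) (e d x) =
      mvfderiv (𝓡 4) (christoffel e b d c) x (e a x)
        + ∑ f, christoffel e a d f x * christoffel e b f c x := by
  have h := mvfderiv_inner (he.mdifferentiableAt hx a)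
    ((he.contMDiffAt_leviCivita hx b c).mdifferentiableAt (by simp)) (he.mdifferentiableAt hx d)
  have hΓ : inner ℝ (leviCivita (e b) (e c) x) (leviCivita (e a) (e d) x) =
      ∑ f, christoffel e b f c x * christoffel e a f d x := (he.sum_inner_mul_inner hx _ _).symm
  simp only [hΓ, fun f => he.christoffel_skew hx a f d, mul_neg, Finset.sum_neg_distrib] at h
  simp only [mul_comm (christoffel e a d _ x)]
  exact (sub_eq_iff_eq_add.1 h.symm)

lemma leviCivita_mlieBracket (he : IsOrthonormalFrame U e) (hx : x ∈ U) (a b c : Fin 4) :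
    leviCivita (mlieBracket (𝓡 4) (e a) (e b)) (e c) x =
      ∑ f, (christoffel e a f b x - christoffel e b f a x) • leviCivita (e f) (e c) x := by
  have ht := tensorialAt_leviCivita (he.mdifferentiableAt hx c)
  have hab := (contMDiffAt_mlieBracket (he.contMDiffAt hx a)
    (he.contMDiffAt hx b)).mdifferentiableAt (by simp)
  rw [← ht.mkHom_apply hab, he.mlieBracket_eq_sum hx, map_sum]
  simp only [map_smul, ht.mkHom_apply (he.mdifferentiableAt hx _)]

lemma riemann_eq (he : IsOrthonormalFrame U e) (hx : x ∈ U) (a b c d : Fin 4) :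
    riemann e x a b c d =
      mvfderiv (𝓡 4) (christoffel e b d c) x (e a x)
      - mvfderiv (𝓡 4) (christoffel e a d c) x (e b x)
      + ∑ f, (christoffel e a d f x * christoffel e b f c x
        - christoffel e b d f x * christoffel e a f c x
        - (christoffel e a f b x - christoffel e b f a x) * christoffel e f d c x) := by
  rw [riemann, curvature, he.leviCivita_mlieBracket hx]
  simp only [inner_sub_left, he.inner_leviCivita_leviCivita hx, sum_inner, real_inner_smul_left,
    Finset.sum_sub_distrib, sub_mul, christoffel]
  ring

lemma riemann_skew_left (he : IsOrthonormalFrame U e) (hx : x ∈ U) (a b c d : Fin 4) :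
    riemann e x a b c d = -riemann e x b a c d := by
  rw [he.riemann_eq hx, he.riemann_eq hx]
  simp only [Finset.sum_sub_distrib, sub_mul]
  ring

lemma riemann_skew_right (he : IsOrthonormalFrame U e) (hx : x ∈ U) (a b c d : Fin 4) :
    riemann e x a b c d = -riemann e x a b d c := by
  have hDΓ : ∀ a b, mvfderiv (𝓡 4) (christoffel e a c d) x (e b x)
      = -mvfderiv (𝓡 4) (christoffel e a d c) x (e b x) := by
    intro a b
    rw [mvfderiv_congr (g := -christoffel e a d c), mvfderiv_neg]
    · rfl
    · filter_upwards [he.isOpen.mem_nhds hx] with y hy using he.christoffel_skew hy a c d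
  have hΓΓ : ∀ a b, ∑ f, christoffel e a c f x * christoffel e b f d x
      = ∑ f, christoffel e b d f x * christoffel e a f c x := fun a b =>
    Finset.sum_congr rfl fun f _ => by
      rw [he.christoffel_skew hx b d f, he.christoffel_skew hx a c f]
      ring
  rw [he.riemann_eq hx, he.riemann_eq hx, hDΓ, hDΓ]
  simp only [Finset.sum_sub_distrib, hΓΓ, fun f => he.christoffel_skew hx f c d, mul_neg,
    Finset.sum_neg_distrib]
  ring

lemma leviCivita_mlieBracket_eq (he : IsOrthonormalFrame U e) (hx : x ∈ U) (a b c : Fin 4) :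
    leviCivita (e a) (leviCivita (e b) (e c)) x - leviCivita (e a) (leviCivita (e c) (e b)) x
      - leviCivita (mlieBracket (𝓡 4) (e b) (e c)) (e a) x
      = mlieBracket (𝓡 4) (e a) (mlieBracket (𝓡 4) (e b) (e c)) x := by
  have htorsion : leviCivita (e b) (e c) =
      leviCivita (e c) (e b) + mlieBracket (𝓡 4) (e b) (e c) := by
    funext y
    rw [Pi.add_apply, ← leviCivita_sub_leviCivita, add_sub_cancel]
  rw [htorsion, leviCivita_add (he.mdifferentiableAt hx a)
      ((he.contMDiffAt_leviCivita hx c b).mdifferentiableAt (by simp))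
      ((contMDiffAt_mlieBracket (he.contMDiffAt hx b)
        (he.contMDiffAt hx c)).mdifferentiableAt (by simp)),
    ← leviCivita_sub_leviCivita (e a)]
  abel

lemma bianchi (he : IsOrthonormalFrame U e) (hx : x ∈ U) (a b c d : Fin 4) :
    riemann e x a b c d + riemann e x b c a d + riemann e x c a b d = 0 := by
  have h : curvature (e a) (e b) (e c) x + curvature (e b) (e c) (e a) x
      + curvature (e c) (e a) (e b) x = 0 := by
    rw [← he.mlieBracket_cyclic hx a b c]
    simp only [← he.leviCivita_mlieBracket_eq hx, curvature]
    abel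
  simp only [riemann, ← inner_add_left, h, inner_zero_left]

end IsOrthonormalFrame

end OrthonormalFrames

section FrameDerivative

open VectorField

variable {M : Type*} [TopologicalSpace M] [ChartedSpace E4 M] {U : Set M}
  {e : Fin 4 → Π x : M, TangentSpace (𝓡 4) x} {x : M} {f g : M → ℂ}

/-- Smoothness of a complex function on a set, over the real numbers. -/
abbrev SmoothC (U : Set M) (f : M → ℂ) : Prop := ContMDiffOn (𝓡 4) 𝓘(ℝ, ℂ) ∞ f U

/-- The derivative of a complex function along the vector `e_a` of a frame. -/
def frameDeriv (e : Fin 4 → Π x : M, TangentSpace (𝓡 4) x) (a : Fin 4) (f : M → ℂ) (x : M) : ℂ :=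
  mvfderiv (𝓡 4) f x (e a x)

instance : ContMDiffMul 𝓘(ℝ, ℂ) ∞ ℂ where
  contMDiff_mul := by
    rw [← modelWithCornersSelf_prod, chartedSpaceSelf_prod]
    exact contDiff_mul.contMDiff

namespace SmoothC

lemma const (c : ℂ) : SmoothC U (fun _ => c) := contMDiffOn_const

lemma ofReal {f : M → ℝ} (hf : ContMDiffOn (𝓡 4) 𝓘(ℝ) ∞ f U) : SmoothC U (fun y => (f y : ℂ)) :=
  Complex.ofRealCLM.contMDiff.comp_contMDiffOn hf

lemma add (hf : SmoothC U f) (hg : SmoothC U g) : SmoothC U (fun y => f y + g y) :=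
  ContMDiffOn.add hf hg

lemma mul (hf : SmoothC U f) (hg : SmoothC U g) : SmoothC U (fun y => f y * g y) :=
  ContMDiffOn.mul hf hg

lemma sum {ι : Type*} {s : Finset ι} {F : ι → M → ℂ} (hF : ∀ i ∈ s, SmoothC U (F i)) :
    SmoothC U (fun y => ∑ i ∈ s, F i y) :=
  contMDiffOn_finsetSum hF

lemma prod {ι : Type*} {s : Finset ι} {F : ι → M → ℂ} (hF : ∀ i ∈ s, SmoothC U (F i)) :
    SmoothC U (fun y => ∏ i ∈ s, F i y) :=
  contMDiffOn_finsetProd hF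

lemma mdifferentiableAt (hf : SmoothC U f) (hU : IsOpen U) (hx : x ∈ U) :
    MDifferentiableAt (𝓡 4) 𝓘(ℝ, ℂ) f x :=
  mdifferentiableAt_of_contMDiffOn hU hf hx

end SmoothC

lemma frameDeriv_const (a : Fin 4) (c : ℂ) : frameDeriv e a (fun _ => c) x = 0 := by
  rw [frameDeriv, mvfderiv_const, zero_apply]

lemma frameDeriv_ofReal {f : M → ℝ} (hU : IsOpen U) (hx : x ∈ U) (a : Fin 4)
    (hf : ContMDiffOn (𝓡 4) 𝓘(ℝ) ∞ f U) :
    frameDeriv e a (fun y => (f y : ℂ)) x = (mvfderiv (𝓡 4) f x (e a x) : ℝ) :=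
  mvfderiv_clm_comp Complex.ofRealCLM (mdifferentiableAt_of_contMDiffOn hU hf hx) _

lemma frameDeriv_add (hU : IsOpen U) (hx : x ∈ U) (a : Fin 4) (hf : SmoothC U f)
    (hg : SmoothC U g) :
    frameDeriv e a (fun y => f y + g y) x = frameDeriv e a f x + frameDeriv e a g x :=
  congr($(mvfderiv_add (hf.mdifferentiableAt hU hx) (hg.mdifferentiableAt hU hx)) (e a x))

lemma frameDeriv_mul (hU : IsOpen U) (hx : x ∈ U) (a : Fin 4) (hf : SmoothC U f)
    (hg : SmoothC U g) :
    frameDeriv e a (fun y => f y * g y) x =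
      frameDeriv e a f x * g x + f x * frameDeriv e a g x := by
  have h := (hf.mdifferentiableAt hU hx).hasMFDerivAt.mul (hg.mdifferentiableAt hU hx).hasMFDerivAt
  rw [add_comm, mul_comm (frameDeriv e a f x)]
  exact congr($(h.mfderiv) (e a x))

lemma frameDeriv_const_mul (hU : IsOpen U) (hx : x ∈ U) (a : Fin 4) (hf : SmoothC U f) (c : ℂ) :
    frameDeriv e a (fun y => c * f y) x = c * frameDeriv e a f x := by
  rw [frameDeriv_mul hU hx a (.const c) hf, frameDeriv_const, zero_mul, zero_add]

lemma frameDeriv_sum (hU : IsOpen U) (hx : x ∈ U) (a : Fin 4) {ι : Type*} {s : Finset ι}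
    {F : ι → M → ℂ} (hF : ∀ i ∈ s, SmoothC U (F i)) :
    frameDeriv e a (fun y => ∑ i ∈ s, F i y) x = ∑ i ∈ s, frameDeriv e a (F i) x := by
  classical
  induction s using Finset.induction_on with
  | empty => simpa using frameDeriv_const a 0
  | insert b s hb h =>
    have hF' : ∀ i ∈ s, SmoothC U (F i) := fun i hi => hF i (Finset.mem_insert_of_mem hi)
    simp only [Finset.sum_insert hb]
    rw [frameDeriv_add hU hx a (hF b (Finset.mem_insert_self b s)) (.sum hF'), h hF']

variable [IsManifold (𝓡 4) ∞ M] [Bundle.RiemannianBundle (fun x : M => TangentSpace (𝓡 4) x)]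

lemma SmoothC.frameDeriv (he : IsOrthonormalFrame U e) (hf : SmoothC U f) (a : Fin 4) :
    SmoothC U (frameDeriv e a f) :=
  contMDiffOn_mvfderiv_apply he.isOpen hf (he.smooth a)

lemma frameDeriv_comm (he : IsOrthonormalFrame U e) (hx : x ∈ U) (hf : SmoothC U f) (a b : Fin 4) :
    frameDeriv e a (frameDeriv e b f) x - frameDeriv e b (frameDeriv e a f) x =
      ∑ c, ((christoffel e a c b x : ℂ) - christoffel e b c a x) * frameDeriv e c f x := by
  refine (mvfderiv_mvfderiv_sub he.isOpen hx (he.smooth a) (he.smooth b) hf).trans ?_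
  simp only [he.mlieBracket_eq_sum hx, map_sum, map_smul, Complex.real_smul, Complex.ofReal_sub,
    SpinFour.frameDeriv]

end FrameDerivative

section SpinRepresentation

/-- The projection of `𝔰𝔬(4) = 𝔰𝔲(2) ⊕ 𝔰𝔲(2)` to the first factor, given by the same formula on all
matrices. -/
def spinPlus : Matrix (Fin 4) (Fin 4) ℝ →ₗ[ℝ] Matrix (Fin 2) (Fin 2) ℂ where
  toFun Ω := (1 / 4 : ℂ) • ∑ a, ∑ b, (Ω a b : ℂ) • (quat a * (quat b).conjTranspose)
  map_add' Ω Ω' := by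
    simp only [Matrix.add_apply, Complex.ofReal_add, add_smul, Finset.sum_add_distrib, smul_add]
  map_smul' c Ω := by
    simp only [Matrix.smul_apply, smul_eq_mul, Complex.ofReal_mul, mul_smul, Complex.coe_smul,
      Finset.smul_sum, RingHom.id_apply, smul_comm c (1 / 4 : ℂ)]

/-- The projection of `𝔰𝔬(4) = 𝔰𝔲(2) ⊕ 𝔰𝔲(2)` to the second factor, given by the same formula on all
matrices. -/
def spinMinus : Matrix (Fin 4) (Fin 4) ℝ →ₗ[ℝ] Matrix (Fin 2) (Fin 2) ℂ where
  toFun Ω := (1 / 4 : ℂ) • ∑ a, ∑ b, (Ω a b : ℂ) • ((quat a).conjTranspose * quat b)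
  map_add' Ω Ω' := by
    simp only [Matrix.add_apply, Complex.ofReal_add, add_smul, Finset.sum_add_distrib, smul_add]
  map_smul' c Ω := by
    simp only [Matrix.smul_apply, smul_eq_mul, Complex.ofReal_mul, mul_smul, Complex.coe_smul,
      Finset.smul_sum, RingHom.id_apply, smul_comm c (1 / 4 : ℂ)]

/-- The coordinates of the self-dual part of a skew matrix. -/
def sdPart (Ω : Matrix (Fin 4) (Fin 4) ℝ) : Fin 3 → ℝ :=
  ![Ω 1 0 + Ω 3 2, Ω 2 0 + Ω 1 3, Ω 3 0 + Ω 2 1]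

/-- The coordinates of the anti-self-dual part of a skew matrix. -/
def asdPart (Ω : Matrix (Fin 4) (Fin 4) ℝ) : Fin 3 → ℝ :=
  ![-Ω 1 0 + Ω 3 2, -Ω 2 0 + Ω 1 3, -Ω 3 0 + Ω 2 1]

/-- The imaginary quaternion with the given coordinates, as a complex matrix. -/
def imQuat (u : Fin 3 → ℝ) : Matrix (Fin 2) (Fin 2) ℂ := ∑ i, (u i : ℂ) • quat i.succ

/-- A skew-symmetric `4 × 4` matrix. -/
def IsSkew (Ω : Matrix (Fin 4) (Fin 4) ℝ) : Prop := ∀ a b, Ω a b = -Ω b a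

lemma imQuat_eq (u : Fin 3 → ℝ) : imQuat u =
    !![u 0 * Complex.I, u 1 + u 2 * Complex.I; -u 1 + u 2 * Complex.I, -(u 0 * Complex.I)] := by
  ext A B
  fin_cases A <;> fin_cases B <;> simp [imQuat, quat, Fin.sum_univ_three]

lemma imQuat_lie (u v : Fin 3 → ℝ) :
    ⁅imQuat u, imQuat v⁆ = (2 : ℂ) • imQuat (crossProduct u v) := by
  simp only [Ring.lie_def, imQuat_eq, cross_apply]
  ext A B
  fin_cases A <;> fin_cases B <;> simp <;> ring_nf <;>
    simp only [Complex.I_sq] <;> ring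

variable {Ω Ω' : Matrix (Fin 4) (Fin 4) ℝ}

lemma sdPart_neg (Ω : Matrix (Fin 4) (Fin 4) ℝ) : sdPart (-Ω) = -sdPart Ω := by
  ext j
  fin_cases j <;> simp [sdPart] <;> ring

lemma asdPart_neg (Ω : Matrix (Fin 4) (Fin 4) ℝ) : asdPart (-Ω) = -asdPart Ω := by
  ext j
  fin_cases j <;> simp [asdPart] <;> ring

namespace IsSkew

lemma transpose_eq (h : IsSkew Ω) : Ω.transpose = -Ω := Matrix.ext fun a b => h b a

lemma apply_self (h : IsSkew Ω) (a : Fin 4) : Ω a a = 0 := self_eq_neg.1 (h a a)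

lemma apply_lower (h : IsSkew Ω) :
    Ω 1 0 = -Ω 0 1 ∧ Ω 2 0 = -Ω 0 2 ∧ Ω 3 0 = -Ω 0 3 ∧
      Ω 2 1 = -Ω 1 2 ∧ Ω 3 1 = -Ω 1 3 ∧ Ω 3 2 = -Ω 2 3 :=
  ⟨h _ _, h _ _, h _ _, h _ _, h _ _, h _ _⟩

lemma lie (h : IsSkew Ω) (h' : IsSkew Ω') : IsSkew ⁅Ω, Ω'⁆ := by
  intro a b
  simp only [Ring.lie_def, Matrix.sub_apply, Matrix.mul_apply, neg_sub]
  congr 1 <;> refine Finset.sum_congr rfl fun f _ => ?_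
  · rw [h a f, h' f b]; ring
  · rw [h' a f, h f b]; ring

lemma eq_zero_iff (h : IsSkew Ω) : (∀ a b, Ω a b = 0) ↔ sdPart Ω = 0 ∧ asdPart Ω = 0 := by
  refine ⟨fun h0 => by simp [sdPart, asdPart, h0], fun ⟨hs, ha⟩ => ?_⟩
  simp only [sdPart, asdPart, h.apply_lower, Matrix.cons_eq_zero_iff] at hs ha
  intro a b
  fin_cases a <;> fin_cases b <;> simp only [Fin.mk_zero, Fin.mk_one, Fin.reduceFinMk,
    h.apply_self, h.apply_lower, neg_eq_zero] <;> linarith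

lemma sdPart_lie (h : IsSkew Ω) (h' : IsSkew Ω') :
    sdPart ⁅Ω, Ω'⁆ = crossProduct (sdPart Ω) (sdPart Ω') := by
  ext j
  fin_cases j <;> simp [sdPart, cross_apply, Ring.lie_def, Matrix.mul_apply, Fin.sum_univ_four,
    h.apply_self, h.apply_lower, h'.apply_self, h'.apply_lower] <;> ring

lemma asdPart_lie (h : IsSkew Ω) (h' : IsSkew Ω') :
    asdPart ⁅Ω, Ω'⁆ = crossProduct (asdPart Ω) (asdPart Ω') := by
  ext j
  fin_cases j <;> simp [asdPart, cross_apply, Ring.lie_def, Matrix.mul_apply, Fin.sum_univ_four,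
    h.apply_self, h.apply_lower, h'.apply_self, h'.apply_lower] <;> ring

end IsSkew

lemma spinPlus_apply (Ω : Matrix (Fin 4) (Fin 4) ℝ) (A B : Fin 2) : spinPlus Ω A B =
    ∑ a, ∑ b, ((1 / 4 : ℂ) * (quat a * (quat b).conjTranspose) A B) * (Ω a b : ℂ) := by
  simp only [spinPlus, LinearMap.coe_mk, AddHom.coe_mk, Matrix.smul_apply, Matrix.sum_apply,
    smul_eq_mul, Finset.mul_sum, mul_assoc, mul_comm (Ω _ _ : ℂ)]

lemma spinMinus_apply (Ω : Matrix (Fin 4) (Fin 4) ℝ) (A B : Fin 2) : spinMinus Ω A B =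
    ∑ a, ∑ b, ((1 / 4 : ℂ) * ((quat a).conjTranspose * quat b) A B) * (Ω a b : ℂ) := by
  simp only [spinMinus, LinearMap.coe_mk, AddHom.coe_mk, Matrix.smul_apply, Matrix.sum_apply,
    smul_eq_mul, Finset.mul_sum, mul_assoc, mul_comm (Ω _ _ : ℂ)]

lemma spinPlus_eq (h : IsSkew Ω) : spinPlus Ω = (1 / 2 : ℂ) • imQuat (sdPart Ω) := by
  ext A B
  rw [spinPlus_apply, imQuat_eq]
  simp only [Fin.sum_univ_four, h.apply_self, h.apply_lower, Matrix.smul_apply]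
  fin_cases A <;> fin_cases B <;>
    simp [sdPart, quat, Matrix.mul_apply, h.apply_lower] <;> ring

lemma spinMinus_eq (h : IsSkew Ω) : spinMinus Ω = (1 / 2 : ℂ) • imQuat (asdPart Ω) := by
  ext A B
  rw [spinMinus_apply, imQuat_eq]
  simp only [Fin.sum_univ_four, h.apply_self, h.apply_lower, Matrix.smul_apply]
  fin_cases A <;> fin_cases B <;>
    simp [asdPart, quat, Matrix.mul_apply, h.apply_lower] <;> ring

lemma spinPlus_transpose (h : IsSkew Ω) :
    spinPlus Ω.transpose = -((1 / 2 : ℂ) • imQuat (sdPart Ω)) := by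
  rw [h.transpose_eq, map_neg, spinPlus_eq h]

lemma spinMinus_transpose (h : IsSkew Ω) :
    spinMinus Ω.transpose = -((1 / 2 : ℂ) • imQuat (asdPart Ω)) := by
  rw [h.transpose_eq, map_neg, spinMinus_eq h]

lemma spinPlus_lie (h : IsSkew Ω) (h' : IsSkew Ω') :
    spinPlus ⁅Ω, Ω'⁆ = ⁅spinPlus Ω, spinPlus Ω'⁆ := by
  rw [spinPlus_eq h, spinPlus_eq h', spinPlus_eq (h.lie h'), h.sdPart_lie h', Ring.lie_def,
    smul_mul_smul_comm, smul_mul_smul_comm, ← smul_sub, ← Ring.lie_def, imQuat_lie, smul_smul]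
  norm_num

lemma spinMinus_lie (h : IsSkew Ω) (h' : IsSkew Ω') :
    spinMinus ⁅Ω, Ω'⁆ = ⁅spinMinus Ω, spinMinus Ω'⁆ := by
  rw [spinMinus_eq h, spinMinus_eq h', spinMinus_eq (h.lie h'), h.asdPart_lie h', Ring.lie_def,
    smul_mul_smul_comm, smul_mul_smul_comm, ← smul_sub, ← Ring.lie_def, imQuat_lie, smul_smul]
  norm_num

lemma spin_soldering (h : IsSkew Ω) (b : Fin 4) (B B' : Fin 2) :
    ∑ X, spinPlus Ω B X * soldering b X B' + ∑ X, spinMinus Ω B' X * soldering b B X =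
      ∑ a, (Ω a b : ℂ) * soldering a B B' := by
  rw [spinPlus_eq h, spinMinus_eq h, imQuat_eq, imQuat_eq]
  simp only [Fin.sum_univ_four, Fin.sum_univ_two, soldering, Matrix.mul_apply, Matrix.smul_apply]
  fin_cases b <;> fin_cases B <;> fin_cases B' <;>
    simp [sdPart, asdPart, quat, eps, h.apply_self, h.apply_lower] <;>
    ring_nf <;> simp only [Complex.I_sq] <;> ring

lemma trace_spinMinus (h : IsSkew Ω) : (spinMinus Ω).trace = 0 := by
  rw [spinMinus_eq h, imQuat_eq]
  simp [Matrix.trace_fin_two]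

/-- The contraction `σ_c^{P A'} σ_b^{Q B'} ε_{A'B'}` of two soldering forms. -/
def solderPair (c b : Fin 4) (P Q : Fin 2) : ℂ :=
  ∑ B', ∑ C', eps B' C' * (soldering c P B' * soldering b Q C')

lemma solderPair_swap (c b : Fin 4) (P Q : Fin 2) : solderPair c b Q P = -solderPair b c P Q := by
  simp only [solderPair, Fin.sum_univ_two, eps, Matrix.of_apply, Matrix.cons_val_zero,
    Matrix.cons_val_one, Matrix.cons_val_fin_one]
  ring

lemma sum_solderPair (h : IsSkew Ω) (P Q : Fin 2) :
    ∑ c, ∑ b, solderPair c b P Q * (Ω c b : ℂ) =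
      2 * ∑ i, (sdPart Ω i : ℂ) * soldering i.succ P Q := by
  simp only [Fin.sum_univ_four, solderPair, Fin.sum_univ_two, Fin.sum_univ_three, soldering,
    Matrix.mul_apply, h.apply_self, h.apply_lower]
  fin_cases P <;> fin_cases Q <;>
    simp [sdPart, quat, eps, h.apply_lower] <;> ring

end SpinRepresentation

section CurvatureTensor

/-- The algebraic symmetries of a Riemann tensor. -/
structure IsCurvatureTensor (R : Fin 4 → Fin 4 → Fin 4 → Fin 4 → ℝ) : Prop where
  skew_left : ∀ a b c d, R a b c d = -R b a c d
  skew_right : ∀ a b c d, R a b c d = -R a b d c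
  bianchi : ∀ a b c d, R a b c d + R b c a d + R c a b d = 0

/-- The block of a curvature tensor that maps self-dual to self-dual two-forms. -/
def blockPlus (R : Fin 4 → Fin 4 → Fin 4 → Fin 4 → ℝ) : Matrix (Fin 3) (Fin 3) ℝ :=
  Matrix.of fun i j => sdPart (fun a b => sdPart (R a b) j) i

/-- The block of a curvature tensor that pairs self-dual with anti-self-dual two-forms. -/
def blockMixed (R : Fin 4 → Fin 4 → Fin 4 → Fin 4 → ℝ) : Matrix (Fin 3) (Fin 3) ℝ :=
  Matrix.of fun i j => sdPart (fun a b => asdPart (R a b) j) i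

lemma blockPlus_apply (R : Fin 4 → Fin 4 → Fin 4 → Fin 4 → ℝ) (i j : Fin 3) :
    blockPlus R i j = sdPart (fun c d => sdPart (fun a b => R a b c d) i) j := by
  fin_cases i <;> fin_cases j <;> simp [blockPlus, sdPart] <;> ring

lemma blockMixed_apply (R : Fin 4 → Fin 4 → Fin 4 → Fin 4 → ℝ) (i j : Fin 3) :
    blockMixed R i j = asdPart (fun c d => sdPart (fun a b => R a b c d) i) j := by
  fin_cases i <;> fin_cases j <;> simp [blockMixed, sdPart, asdPart] <;> ring

namespace IsCurvatureTensor

variable {R : Fin 4 → Fin 4 → Fin 4 → Fin 4 → ℝ}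

lemma pair_symm (hR : IsCurvatureTensor R) (a b c d : Fin 4) : R a b c d = R c d a b := by
  linarith [hR.bianchi a b c d, hR.bianchi b c d a, hR.bianchi c d a b, hR.bianchi d a b c,
    hR.skew_left c a b d, hR.skew_right a c b d, hR.skew_left d b c a, hR.skew_right b d a c,
    hR.skew_right a b c d, hR.skew_right b c a d, hR.skew_right c d a b, hR.skew_right d a b c]

lemma skew_lower (hR : IsCurvatureTensor R) (c d : Fin 4) :
    R 1 0 c d = -R 0 1 c d ∧ R 2 0 c d = -R 0 2 c d ∧ R 3 0 c d = -R 0 3 c d ∧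
      R 2 1 c d = -R 1 2 c d ∧ R 3 1 c d = -R 1 3 c d ∧ R 3 2 c d = -R 2 3 c d :=
  IsSkew.apply_lower (Ω := fun a b => R a b c d) fun a b => hR.skew_left a b c d

lemma skew_lower_right (hR : IsCurvatureTensor R) (a b : Fin 4) :
    R a b 1 0 = -R a b 0 1 ∧ R a b 2 0 = -R a b 0 2 ∧ R a b 3 0 = -R a b 0 3 ∧
      R a b 2 1 = -R a b 1 2 ∧ R a b 3 1 = -R a b 1 3 ∧ R a b 3 2 = -R a b 2 3 :=
  IsSkew.apply_lower (Ω := R a b) (hR.skew_right a b)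

lemma apply_self (hR : IsCurvatureTensor R) (a c d : Fin 4) : R a a c d = 0 :=
  self_eq_neg.1 (hR.skew_left a a c d)

lemma apply_self_right (hR : IsCurvatureTensor R) (a b c : Fin 4) : R a b c c = 0 :=
  self_eq_neg.1 (hR.skew_right a b c c)

lemma pair_lower (hR : IsCurvatureTensor R) :
    (R 0 2 0 1 = R 0 1 0 2 ∧ R 0 3 0 1 = R 0 1 0 3 ∧ R 1 2 0 1 = R 0 1 1 2 ∧
      R 1 3 0 1 = R 0 1 1 3 ∧ R 2 3 0 1 = R 0 1 2 3) ∧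
    (R 0 3 0 2 = R 0 2 0 3 ∧ R 1 2 0 2 = R 0 2 1 2 ∧ R 1 3 0 2 = R 0 2 1 3 ∧
      R 2 3 0 2 = R 0 2 2 3) ∧
    (R 1 2 0 3 = R 0 3 1 2 ∧ R 1 3 0 3 = R 0 3 1 3 ∧ R 2 3 0 3 = R 0 3 2 3) ∧
    R 1 3 1 2 = R 1 2 1 3 ∧ R 2 3 1 2 = R 1 2 2 3 ∧ R 2 3 1 3 = R 1 3 2 3 := by
  have := hR.pair_symm
  refine ⟨⟨?_, ?_, ?_, ?_, ?_⟩, ⟨?_, ?_, ?_, ?_⟩, ⟨?_, ?_, ?_⟩, ?_, ?_, ?_⟩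
  all_goals exact this _ _ _ _

lemma isSymm_blockPlus (hR : IsCurvatureTensor R) : (blockPlus R).IsSymm := by
  ext i j
  rw [Matrix.transpose_apply, blockPlus_apply]
  simp only [blockPlus, Matrix.of_apply, fun a b c d => hR.pair_symm c d a b]

lemma blockMixed_eq (hR : IsCurvatureTensor R) {S : Fin 4 → Fin 4 → ℝ}
    (hS : ∀ b c, S b c = ∑ a, R a b c a) :
    blockMixed R =
      !![(S 0 0 + S 1 1 - S 2 2 - S 3 3) / 2, S 1 2 - S 0 3, S 1 3 + S 0 2;
        S 1 2 + S 0 3, (S 0 0 + S 2 2 - S 1 1 - S 3 3) / 2, S 2 3 - S 0 1;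
        S 1 3 - S 0 2, S 2 3 + S 0 1, (S 0 0 + S 3 3 - S 1 1 - S 2 2) / 2] := by
  ext i j
  fin_cases i <;> fin_cases j <;>
    simp [blockMixed, sdPart, asdPart, hS, Fin.sum_univ_four, hR.apply_self, hR.apply_self_right,
      hR.skew_lower, hR.skew_lower_right, hR.pair_lower] <;> ring

lemma trace_blockPlus (hR : IsCurvatureTensor R) :
    (blockPlus R).trace = -(∑ a, ∑ b, R a b b a) / 2 := by
  have h1203 := hR.bianchi 1 2 0 3
  simp only [hR.skew_lower, hR.pair_lower] at h1203
  simp only [Matrix.trace, Matrix.diag_apply, blockPlus, sdPart, Matrix.of_apply,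
    Fin.sum_univ_three, Fin.sum_univ_four, Matrix.cons_val, hR.apply_self, hR.skew_lower,
    hR.skew_lower_right, hR.pair_lower]
  linarith

end IsCurvatureTensor

lemma volSymbol_eq (a b c d : Fin 4) : volSymbol a b c d =
    ((((b : ℤ) - a) * (c - a) * (d - a) * (c - b) * (d - b) * (d - c) / 12 : ℤ) : ℝ) := by
  unfold volSymbol
  congr 1
  simp only [Matrix.det_succ_row_zero, Fin.sum_univ_succ]
  revert a b c d
  decide

lemma volSymbol_swap (a b c d : Fin 4) : volSymbol a b c d = -volSymbol b a c d := by
  rw [volSymbol_eq, volSymbol_eq, ← Int.cast_neg]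
  congr 1
  revert a b c d
  decide

/-- The self-dual part `(T + ⋆T) / 2` of a skew matrix `T`. -/
def selfDual (T : Matrix (Fin 4) (Fin 4) ℝ) : Matrix (Fin 4) (Fin 4) ℝ :=
  Matrix.of fun a b => (1 / 2) * (T a b + (1 / 2) * ∑ p, ∑ r, volSymbol a b p r * T p r)

namespace IsSkew

variable {T : Matrix (Fin 4) (Fin 4) ℝ}

lemma selfDual (h : IsSkew T) : IsSkew (selfDual T) := by
  intro a b
  simp only [SpinFour.selfDual, Matrix.of_apply, h a b, volSymbol_swap a b, neg_mul,
    Finset.sum_neg_distrib]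
  ring

lemma selfDual_apply (h : IsSkew T) {a b c d : Fin 4}
    (hv : ∀ p r : Fin 4, ((b : ℤ) - a) * (p - a) * (r - a) * (p - b) * (r - b) * (r - p) / 12 =
      (if c = p ∧ d = r then 1 else 0) - if d = p ∧ c = r then 1 else 0) :
    SpinFour.selfDual T a b = (T a b + T c d) / 2 := by
  have hsum : ∑ p, ∑ r, volSymbol a b p r * T p r = 2 * T c d := by
    simp only [volSymbol_eq, hv]
    simp only [Int.cast_sub, Int.cast_ite, Int.cast_one, Int.cast_zero, sub_mul,
      ite_mul, one_mul, zero_mul, ite_and, Finset.sum_sub_distrib, Finset.sum_ite_irrel,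
      Finset.sum_const_zero, Finset.sum_ite_eq, Finset.mem_univ, if_true, h d c]
    ring
  rw [SpinFour.selfDual, Matrix.of_apply, hsum]
  ring

lemma selfDual_apply_basis (h : IsSkew T) :
    (SpinFour.selfDual T 1 0 = sdPart T 0 / 2 ∧ SpinFour.selfDual T 3 2 = sdPart T 0 / 2) ∧
      (SpinFour.selfDual T 2 0 = sdPart T 1 / 2 ∧ SpinFour.selfDual T 1 3 = sdPart T 1 / 2) ∧
      SpinFour.selfDual T 3 0 = sdPart T 2 / 2 ∧ SpinFour.selfDual T 2 1 = sdPart T 2 / 2 := by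
  rw [h.selfDual_apply (a := 1) (b := 0) (c := 3) (d := 2) (by decide),
    h.selfDual_apply (a := 3) (b := 2) (c := 1) (d := 0) (by decide),
    h.selfDual_apply (a := 2) (b := 0) (c := 1) (d := 3) (by decide),
    h.selfDual_apply (a := 1) (b := 3) (c := 2) (d := 0) (by decide),
    h.selfDual_apply (a := 3) (b := 0) (c := 2) (d := 1) (by decide),
    h.selfDual_apply (a := 2) (b := 1) (c := 3) (d := 0) (by decide)]
  simp [sdPart, add_comm]

lemma sdPart_selfDual (h : IsSkew T) : sdPart (SpinFour.selfDual T) = sdPart T := by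
  ext i
  rw [sdPart]
  fin_cases i <;> simp [h.selfDual_apply_basis]

lemma asdPart_selfDual (h : IsSkew T) : asdPart (SpinFour.selfDual T) = 0 := by
  ext i
  rw [asdPart]
  fin_cases i <;> simp [h.selfDual_apply_basis]

lemma selfDual_eq_zero_iff (h : IsSkew T) :
    (∀ a b, SpinFour.selfDual T a b = 0) ↔ sdPart T = 0 := by
  rw [h.selfDual.eq_zero_iff, h.sdPart_selfDual, h.asdPart_selfDual, eq_self, and_true]

end IsSkew

section Weyl

variable {M : Type*} [TopologicalSpace M] [ChartedSpace E4 M] [IsManifold (𝓡 4) ∞ M]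
  [Bundle.RiemannianBundle (fun x : M => TangentSpace (𝓡 4) x)]
  {e : Fin 4 → Π x : M, TangentSpace (𝓡 4) x} {x : M}

lemma sum_weyl (b c : Fin 4) : ∑ a, weyl e x a b c a = 0 := by
  have hdelta (f : Fin 4 → ℝ) (i : Fin 4) :
      ∑ a, f a * kdelta a i = f i ∧ ∑ a, f a * kdelta i a = f i := by
    simp [kdelta]
  have hself (a : Fin 4) : kdelta a a = 1 := if_pos rfl
  simp only [weyl, Finset.sum_add_distrib, Finset.sum_sub_distrib, ← Finset.mul_sum,
    ← Finset.sum_mul, hself, hdelta, Finset.sum_const, Finset.card_univ, Fintype.card_fin]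
  rw [← ricci, ← scalar]
  ring

namespace IsCurvatureTensor

lemma ricci_comm (hR : IsCurvatureTensor (riemann e x)) (b c : Fin 4) :
    ricci e x b c = ricci e x c b :=
  Finset.sum_congr rfl fun a _ => by rw [hR.pair_symm, hR.skew_left, hR.skew_right, neg_neg]

lemma weyl (hR : IsCurvatureTensor (riemann e x)) : IsCurvatureTensor (weyl e x) where
  skew_left a b c d := by
    simp only [SpinFour.weyl]
    rw [hR.skew_left]
    ring
  skew_right a b c d := by
    simp only [SpinFour.weyl]
    rw [hR.skew_right]
    ring
  bianchi a b c d := by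
    have hk (i j : Fin 4) : kdelta i j = kdelta j i := by simp only [kdelta, eq_comm]
    simp only [SpinFour.weyl, hk c a, hk b a, hk c b, hR.ricci_comm c a, hR.ricci_comm b a,
      hR.ricci_comm c b]
    linarith [hR.bianchi a b c d]

lemma ricci_lower (hR : IsCurvatureTensor (riemann e x)) :
    ricci e x 1 0 = ricci e x 0 1 ∧ ricci e x 2 0 = ricci e x 0 2 ∧ ricci e x 3 0 = ricci e x 0 3 ∧
      ricci e x 2 1 = ricci e x 1 2 ∧ ricci e x 3 1 = ricci e x 1 3 ∧
      ricci e x 3 2 = ricci e x 2 3 :=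
  ⟨hR.ricci_comm _ _, hR.ricci_comm _ _, hR.ricci_comm _ _, hR.ricci_comm _ _, hR.ricci_comm _ _,
    hR.ricci_comm _ _⟩

end IsCurvatureTensor

lemma blockPlus_weyl (hR : IsCurvatureTensor (riemann e x)) :
    blockPlus (weyl e x) = blockPlus (riemann e x) + (scalar e x / 6) • 1 := by
  ext i j
  fin_cases i <;> fin_cases j <;>
    simp [blockPlus, sdPart, weyl, scalar, kdelta, Fin.sum_univ_four, hR.ricci_lower] <;> ring

lemma weylPlus_eq_zero_iff_blockPlus_weyl (hR : IsCurvatureTensor (riemann e x)) :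
    (∀ a b c d, weylPlus e x a b c d = 0) ↔ blockPlus (weyl e x) = 0 := by
  have hleft (c d : Fin 4) : IsSkew (fun a b => weyl e x a b c d) :=
    fun a b => hR.weyl.skew_left a b c d
  have hright (i : Fin 3) : IsSkew (fun c d => sdPart (fun a b => weyl e x a b c d) i) := by
    intro c d
    have hneg : (fun a b => weyl e x a b c d) = -fun a b => weyl e x a b d c :=
      funext₂ fun a b => hR.weyl.skew_right a b c d
    exact congrFun ((congrArg sdPart hneg).trans (sdPart_neg _)) i
  have hmixed : blockMixed (weyl e x) = 0 := by
    rw [hR.weyl.blockMixed_eq (S := 0) fun b c => (sum_weyl b c).symm]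
    ext i j
    fin_cases i <;> fin_cases j <;> simp
  calc (∀ a b c d, weylPlus e x a b c d = 0)
      ↔ ∀ c d, sdPart (fun a b => weyl e x a b c d) = 0 := by
        simp only [← (hleft _ _).selfDual_eq_zero_iff]
        exact ⟨fun h c d a b => h a b c d, fun h a b c d => h c d a b⟩
    _ ↔ ∀ i c d, sdPart (fun a b => weyl e x a b c d) i = 0 := by
        simp only [funext_iff, Pi.zero_apply]
        exact ⟨fun h i c d => h c d i, fun h c d i => h i c d⟩
    _ ↔ ∀ i j, blockPlus (weyl e x) i j = 0 ∧ blockMixed (weyl e x) i j = 0 := by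
        simp only [(hright _).eq_zero_iff, funext_iff, blockPlus_apply, blockMixed_apply,
          Pi.zero_apply, forall_and]
    _ ↔ blockPlus (weyl e x) = 0 := by
        simp only [hmixed, Matrix.zero_apply, and_true, ← Matrix.ext_iff]

lemma weylPlus_eq_zero_iff (hR : IsCurvatureTensor (riemann e x)) :
    (∀ a b c d, weylPlus e x a b c d = 0) ↔ ∃ r : ℝ, blockPlus (riemann e x) = r • 1 := by
  rw [weylPlus_eq_zero_iff_blockPlus_weyl hR]
  refine ⟨fun h => ⟨-(scalar e x / 6), ?_⟩, fun ⟨r, h⟩ => ?_⟩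
  · rw [neg_smul, ← add_eq_zero_iff_eq_neg, ← blockPlus_weyl hR, h]
  · have hW : blockPlus (weyl e x) = (r + scalar e x / 6) • 1 := by
      rw [blockPlus_weyl hR, h, add_smul]
    have htrace : (blockPlus (weyl e x)).trace = 0 := by
      rw [hR.weyl.trace_blockPlus, Finset.sum_comm]
      simp [sum_weyl]
    rw [hW, Matrix.trace_smul, Matrix.trace_one, smul_eq_mul, mul_eq_zero] at htrace
    rw [hW, htrace.resolve_right (by simp), zero_smul]

lemma einstein_iff (hR : IsCurvatureTensor (riemann e x)) :
    (∃ r : ℝ, ∀ a b, ricci e x a b = r * kdelta a b) ↔ blockMixed (riemann e x) = 0 := by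
  rw [hR.blockMixed_eq (S := ricci e x) fun _ _ => rfl]
  constructor
  · rintro ⟨r, h⟩
    ext i j
    fin_cases i <;> fin_cases j <;> simp [h, kdelta]
  · intro h
    simp only [Fin.isValue, ← Matrix.ext_iff, Matrix.of_apply, Matrix.cons_val',
      Matrix.cons_val_fin_one, Matrix.zero_apply, Fin.forall_fin_succ, Matrix.cons_val_zero,
      Matrix.cons_val_succ, forall_const, div_eq_zero_iff, OfNat.ofNat_ne_zero, or_false] at h
    refine ⟨ricci e x 0 0, fun a b => ?_⟩
    fin_cases a <;> fin_cases b <;> simp [kdelta, hR.ricci_lower] <;> linarith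

end Weyl

end CurvatureTensor

lemma sum_removeNth_swap {α γ : Type*} [AddCommMonoid γ] {k : ℕ}
    (g : α → α → (Fin k → α) → γ) (A : Fin (k + 2) → α) :
    ∑ p : Fin (k + 2), ∑ q : Fin (k + 1), g (A p) (A (p.succAbove q))
        (fun m => A (p.succAbove (q.succAbove m))) =
      ∑ p : Fin (k + 2), ∑ q : Fin (k + 1), g (A (p.succAbove q)) (A p)
        (fun m => A (p.succAbove (q.succAbove m))) := by
  simp only [← Finset.sum_product', Finset.univ_product_univ]
  refine Finset.sum_bij' (fun pq _ => (pq.1.succAbove pq.2, pq.2.predAbove pq.1))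
    (fun pq _ => (pq.1.succAbove pq.2, pq.2.predAbove pq.1)) (by simp) (by simp) ?_ ?_ ?_
  · rintro ⟨p, q⟩ -
    simp [Fin.succAbove_succAbove_predAbove, Fin.predAbove_predAbove_succAbove]
  · rintro ⟨p, q⟩ -
    simp [Fin.succAbove_succAbove_predAbove, Fin.predAbove_predAbove_succAbove]
  · rintro ⟨p, q⟩ -
    simp [Fin.succAbove_succAbove_predAbove, Fin.succAbove_succAbove_succAbove_predAbove]

section SlotAction

open Function

variable {R ι α : Type*} [CommRing R] [DecidableEq ι] [Fintype α]

/-- The action of a matrix on the index of a tensor in the position `m`. -/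
def slotActAt (m : ι) (P : Matrix α α R) (T : (ι → α) → R) (A : ι → α) : R :=
  ∑ B, P (A m) B * T (update A m B)

variable (P Q : Matrix α α R) (T : (ι → α) → R) (A : ι → α)

lemma slotActAt_sum {κ : Type*} (m : ι) (s : Finset κ) (T : κ → (ι → α) → R) :
    slotActAt m P (fun A => ∑ j ∈ s, T j A) A = ∑ j ∈ s, slotActAt m P (T j) A := by
  simp only [slotActAt, Finset.mul_sum]
  exact Finset.sum_comm

lemma slotActAt_slotActAt_self (m : ι) :
    slotActAt m P (slotActAt m Q T) A = slotActAt m (P * Q) T A := by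
  simp only [slotActAt, update_self, update_idem, Matrix.mul_apply, Finset.sum_mul,
    Finset.mul_sum, mul_assoc]
  exact Finset.sum_comm

lemma slotActAt_comm {m m' : ι} (h : m' ≠ m) :
    slotActAt m P (slotActAt m' Q T) A = slotActAt m' Q (slotActAt m P T) A := by
  simp only [slotActAt, update_of_ne h, update_of_ne h.symm, Finset.mul_sum]
  rw [Finset.sum_comm]
  refine Finset.sum_congr rfl fun B _ => Finset.sum_congr rfl fun C _ => ?_
  rw [update_comm h.symm, mul_left_comm]

variable [Fintype ι]

/-- The derivation action of a matrix on all the indices of a tensor. -/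
def slotAct (P : Matrix α α R) (T : (ι → α) → R) (A : ι → α) : R :=
  ∑ m, slotActAt m P T A

lemma slotAct_add (T' : (ι → α) → R) :
    slotAct P (fun A => T A + T' A) A = slotAct P T A + slotAct P T' A := by
  simp only [slotAct, slotActAt, mul_add, Finset.sum_add_distrib]

lemma slotAct_sum {κ : Type*} (s : Finset κ) (T : κ → (ι → α) → R) :
    slotAct P (fun A => ∑ j ∈ s, T j A) A = ∑ j ∈ s, slotAct P (T j) A := by
  simp only [slotAct, slotActAt_sum]
  exact Finset.sum_comm

lemma slotAct_const_mul (c : R) : slotAct P (fun A => c * T A) A = c * slotAct P T A := by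
  simp only [slotAct, slotActAt, Finset.mul_sum, mul_left_comm]

lemma add_slotAct : slotAct (P + Q) T A = slotAct P T A + slotAct Q T A := by
  simp only [slotAct, slotActAt, Matrix.add_apply, add_mul, Finset.sum_add_distrib]

lemma sub_slotAct : slotAct (P - Q) T A = slotAct P T A - slotAct Q T A := by
  simp only [slotAct, slotActAt, Matrix.sub_apply, sub_mul, Finset.sum_sub_distrib]

lemma smul_slotAct (c : R) : slotAct (c • P) T A = c * slotAct P T A := by
  simp only [slotAct, slotActAt, Matrix.smul_apply, smul_eq_mul, mul_assoc, Finset.mul_sum]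

lemma sum_slotAct {κ : Type*} (s : Finset κ) (P : κ → Matrix α α R) :
    slotAct (∑ j ∈ s, P j) T A = ∑ j ∈ s, slotAct (P j) T A := by
  simp only [slotAct, slotActAt, Matrix.sum_apply, Finset.sum_mul]
  rw [Finset.sum_comm (s := s)]
  refine Finset.sum_congr rfl fun m _ => ?_
  exact Finset.sum_comm

lemma slotAct_slotAct : slotAct P (slotAct Q T) A =
    ∑ m, ∑ m', slotActAt m P (slotActAt m' Q T) A := by
  refine Finset.sum_congr rfl fun m _ => ?_
  exact slotActAt_sum P A m Finset.univ fun m' => slotActAt m' Q T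

lemma slotAct_commutator :
    slotAct P (slotAct Q T) A - slotAct Q (slotAct P T) A = slotAct ⁅P, Q⁆ T A := by
  calc slotAct P (slotAct Q T) A - slotAct Q (slotAct P T) A
      = ∑ m : ι, ∑ m' : ι,
          (slotActAt m P (slotActAt m' Q T) A - slotActAt m' Q (slotActAt m P T) A) := by
        simp only [slotAct_slotAct, Finset.sum_sub_distrib]
        rw [Finset.sum_comm (f := fun m m' => slotActAt m Q (slotActAt m' P T) A)]
    _ = ∑ m, (slotActAt m (P * Q) T A - slotActAt m (Q * P) T A) := by
        refine Finset.sum_congr rfl fun m _ => ?_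
        rw [Finset.sum_eq_single m (fun m' _ h => by rw [slotActAt_comm _ _ _ _ h, sub_self])
          (fun h => absurd (Finset.mem_univ m) h), slotActAt_slotActAt_self,
          slotActAt_slotActAt_self]
    _ = slotAct ⁅P, Q⁆ T A := by
        rw [Ring.lie_def, sub_slotAct, Finset.sum_sub_distrib, slotAct, slotAct]

lemma slotAct_slotAct_comm {κ β : Type*} [Fintype κ] [DecidableEq κ] [Fintype β]
    (Q : Matrix β β R) (T : (ι → α) → (κ → β) → R) (A' : κ → β) :
    slotAct P (fun A => slotAct Q (T A) A') A =
      slotAct Q (fun A' => slotAct P (fun A => T A A') A) A' := by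
  have slotAct_apply : ∀ (T : (κ → β) → R) A', slotAct Q T A' =
      ∑ m', ∑ C, Q (A' m') C * T (update A' m' C) := fun _ _ => rfl
  simp only [slotAct_apply, slotAct_sum, slotAct_const_mul]

section Fin

variable {k : ℕ}

lemma slotAct_insert (G : α → (Fin k → α) → R) (A : Fin (k + 1) → α) :
    slotAct P (fun A => ∑ p : Fin (k + 1), G (A p) (fun m => A (p.succAbove m))) A =
      ∑ p : Fin (k + 1), (∑ X, P (A p) X * G X (fun m => A (p.succAbove m))
        + slotAct P (G (A p)) (fun m => A (p.succAbove m))) := by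
  rw [slotAct_sum]
  refine Finset.sum_congr rfl fun p _ => ?_
  have h : ∀ m X m', update A (p.succAbove m) X (p.succAbove m') =
      update (fun m => A (p.succAbove m)) m X m' := fun m X m' =>
    congrFun (update_comp_eq_of_injective A Fin.succAbove_right_injective m X) m'
  simp only [slotAct, slotActAt, Fin.sum_univ_succAbove _ p, update_self, h,
    update_of_ne (Fin.succAbove_ne p _), update_of_ne (Fin.succAbove_ne p _).symm]

lemma slotAct_snoc (G : (Fin (k + 1) → α) → R) (A : Fin k → α) (C : α) :
    slotAct P (fun A => G (Fin.snoc A C)) A + ∑ X, P C X * G (Fin.snoc A X) =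
      slotAct P G (Fin.snoc A C) := by
  have hl : ∀ m X, update (Fin.snoc (α := fun _ => α) A C) (Fin.castSucc m) X =
      Fin.snoc (α := fun _ => α) (update A m X) C := fun m X =>
    (Fin.snoc_update (α := fun _ => α) ..).symm
  have hr : ∀ X, update (Fin.snoc (α := fun _ => α) A C) (Fin.last k) X =
      Fin.snoc (α := fun _ => α) A X := fun X => Fin.update_snoc_last (α := fun _ => α) ..
  simp only [slotAct, slotActAt, Fin.sum_univ_castSucc (n := k), hl, hr, Fin.snoc_castSucc,
    Fin.snoc_last]

end Fin

section Act

variable {k n : ℕ}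

/-- The derivation action of a pair of matrices on the unprimed and the primed indices of a spin
tensor. -/
def act (P Q : Matrix (Fin 2) (Fin 2) ℂ) (T : SpinTensor k n) : SpinTensor k n :=
  fun A A' => slotAct P (fun A => T A A') A + slotAct Q (T A) A'

lemma act_add (P Q : Matrix (Fin 2) (Fin 2) ℂ) (T T' : SpinTensor k n)
    (A : Fin k → Fin 2) (A' : Fin n → Fin 2) :
    act P Q (fun A A' => T A A' + T' A A') A A' = act P Q T A A' + act P Q T' A A' := by
  rw [act, slotAct_add P (fun A => T A A') A fun A => T' A A', slotAct_add Q (T A) A' (T' A),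
    add_add_add_comm, act, act]

lemma act_commutator (P Q P' Q' : Matrix (Fin 2) (Fin 2) ℂ) (T : SpinTensor k n)
    (A : Fin k → Fin 2) (A' : Fin n → Fin 2) :
    act P Q (act P' Q' T) A A' - act P' Q' (act P Q T) A A' = act ⁅P, P'⁆ ⁅Q, Q'⁆ T A A' := by
  have act_act : ∀ P Q P' Q', act P Q (act P' Q' T) A A' =
      slotAct P (slotAct P' fun A => T A A') A + slotAct P (fun A => slotAct Q' (T A) A') A
      + (slotAct Q (fun A' => slotAct P' (fun A => T A A') A) A'
      + slotAct Q (slotAct Q' (T A)) A') := by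
    intro P Q P' Q'
    rw [← slotAct_add, ← slotAct_add]
    rfl
  rw [act_act, act_act, act, ← slotAct_commutator, ← slotAct_commutator,
    slotAct_slotAct_comm P A Q', slotAct_slotAct_comm P' A Q]
  ring

end Act

end SlotAction

section SlotDerivative

variable {M : Type*} [TopologicalSpace M] [ChartedSpace E4 M] {U : Set M}
  {ι α : Type*} [Fintype ι] [DecidableEq ι] [Fintype α]
  {P : M → Matrix α α ℂ} {T : M → (ι → α) → ℂ}

lemma smoothC_slotAct (hP : ∀ A B, SmoothC U (fun x => P x A B))
    (hT : ∀ A, SmoothC U (fun x => T x A)) (A : ι → α) :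
    SmoothC U (fun x => slotAct (P x) (T x) A) :=
  .sum fun _ _ => .sum fun _ _ => .mul (hP _ _) (hT _)

lemma frameDeriv_slotAct (hU : IsOpen U) {x : M} (hx : x ∈ U)
    {e : Fin 4 → Π x : M, TangentSpace (𝓡 4) x} (a : Fin 4)
    (hP : ∀ A B, SmoothC U (fun x => P x A B)) (hT : ∀ A, SmoothC U (fun x => T x A))
    (A : ι → α) :
    frameDeriv e a (fun x => slotAct (P x) (T x) A) x =
      slotAct (fun A B => frameDeriv e a (fun y => P y A B) x) (T x) A
        + slotAct (P x) (fun A => frameDeriv e a (fun y => T y A) x) A := by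
  simp only [slotAct, slotActAt]
  rw [frameDeriv_sum hU hx a fun m _ => .sum fun B _ => .mul (hP _ _) (hT _),
    ← Finset.sum_add_distrib]
  refine Finset.sum_congr rfl fun m _ => ?_
  rw [frameDeriv_sum hU hx a fun B _ => .mul (hP _ _) (hT _), ← Finset.sum_add_distrib]
  exact Finset.sum_congr rfl fun B _ => frameDeriv_mul hU hx a (hP _ _) (hT _)

end SlotDerivative

section ConnectionMatrices

variable {M : Type*} [TopologicalSpace M] [ChartedSpace E4 M]
  {e : Fin 4 → Π x : M, TangentSpace (𝓡 4) x} {U : Set M} {x : M}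

lemma map_matrix_apply {R : Type*} [CommSemiring R] {m n m' n' A : Type*} [Fintype m] [Fintype n]
    [DecidableEq m] [DecidableEq n] [CommSemiring A] [Algebra R A]
    (L : Matrix m n R →ₗ[R] Matrix m' n' A) (Ω : Matrix m n R) (i : m') (j : n') :
    L Ω i j = ∑ a, ∑ b, L (Matrix.single a b 1) i j * algebraMap R A (Ω a b) := by
  conv_lhs => rw [Matrix.matrix_eq_sum_single Ω]
  simp only [map_sum, Matrix.sum_apply]
  refine Finset.sum_congr rfl fun a _ => Finset.sum_congr rfl fun b _ => ?_
  rw [← mul_one (Ω a b), ← smul_eq_mul, ← Matrix.smul_single, map_smul, Matrix.smul_apply,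
    Algebra.smul_def, mul_comm, smul_eq_mul, mul_one]

lemma smoothC_map_matrix (L : Matrix (Fin 4) (Fin 4) ℝ →ₗ[ℝ] Matrix (Fin 2) (Fin 2) ℂ)
    {Ω : M → Matrix (Fin 4) (Fin 4) ℝ}
    (hΩ : ∀ a b, ContMDiffOn (𝓡 4) 𝓘(ℝ) ∞ (fun y => Ω y a b) U) (A B : Fin 2) :
    SmoothC U (fun y => L (Ω y) A B) := by
  simp only [fun y => map_matrix_apply L (Ω y) A B]
  exact .sum fun a _ => .sum fun b _ => .mul (.const _) (.ofReal (hΩ a b))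

lemma frameDeriv_map_matrix (L : Matrix (Fin 4) (Fin 4) ℝ →ₗ[ℝ] Matrix (Fin 2) (Fin 2) ℂ)
    (hU : IsOpen U) (hx : x ∈ U) {Ω : M → Matrix (Fin 4) (Fin 4) ℝ}
    (hΩ : ∀ a b, ContMDiffOn (𝓡 4) 𝓘(ℝ) ∞ (fun y => Ω y a b) U) (c : Fin 4) (A B : Fin 2) :
    frameDeriv e c (fun y => L (Ω y) A B) x =
      L (.of fun a b => mvfderiv (𝓡 4) (fun y => Ω y a b) x (e c x)) A B := by
  have hL : ∀ Ω, L Ω A B = ∑ a, ∑ b, L (Matrix.single a b 1) A B * (Ω a b : ℂ) :=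
    fun Ω => map_matrix_apply L Ω A B
  have hsmooth : ∀ a b, SmoothC U (fun y => L (Matrix.single a b 1) A B * (Ω y a b : ℂ)) :=
    fun a b => .mul (.const _) (.ofReal (hΩ a b))
  rw [hL (.of _)]
  simp only [fun y => hL (Ω y)]
  rw [frameDeriv_sum hU hx c fun a _ => .sum fun b _ => hsmooth a b]
  refine Finset.sum_congr rfl fun a _ => ?_
  rw [frameDeriv_sum hU hx c fun b _ => hsmooth a b]
  refine Finset.sum_congr rfl fun b _ => ?_
  rw [frameDeriv_const_mul hU hx c (.ofReal (hΩ a b)), frameDeriv_ofReal hU hx c (hΩ a b),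
    Matrix.of_apply]

variable [IsManifold (𝓡 4) ∞ M] [Bundle.RiemannianBundle (fun x : M => TangentSpace (𝓡 4) x)]

/-- The connection matrix `Γ_c` of a frame along its vector `e_c`. -/
def connMatrix (e : Fin 4 → Π x : M, TangentSpace (𝓡 4) x) (c : Fin 4) (x : M) :
    Matrix (Fin 4) (Fin 4) ℝ :=
  fun a b => christoffel e c a b x

/-- The derivative `∂_a Γ_b` of a connection matrix of a frame along the vector `e_a`. -/
def connMatrixDeriv (e : Fin 4 → Π x : M, TangentSpace (𝓡 4) x) (a b : Fin 4) (x : M) :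
    Matrix (Fin 4) (Fin 4) ℝ :=
  fun p q => mvfderiv (𝓡 4) (christoffel e b p q) x (e a x)

/-- The curvature endomorphism of `e_a, e_b` as a matrix: `riemann e x a b q p` is the coefficient
of `e_p` in its value at `e_q`. -/
def curvMatrix (e : Fin 4 → Π x : M, TangentSpace (𝓡 4) x) (a b : Fin 4) (x : M) :
    Matrix (Fin 4) (Fin 4) ℝ :=
  fun p q => riemann e x a b q p

variable [IsContMDiffRiemannianBundle (𝓡 4) ∞ E4 (fun x : M => TangentSpace (𝓡 4) x)]

namespace IsOrthonormalFrame

lemma isSkew_connMatrix (he : IsOrthonormalFrame U e) (hx : x ∈ U) (c : Fin 4) :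
    IsSkew (connMatrix e c x) :=
  he.christoffel_skew hx c

lemma isCurvatureTensor_riemann (he : IsOrthonormalFrame U e) (hx : x ∈ U) :
    IsCurvatureTensor (riemann e x) where
  skew_left := he.riemann_skew_left hx
  skew_right := he.riemann_skew_right hx
  bianchi := he.bianchi hx

lemma curvMatrix_eq (he : IsOrthonormalFrame U e) (hx : x ∈ U) (a b : Fin 4) :
    curvMatrix e a b x = connMatrixDeriv e a b x - connMatrixDeriv e b a x
      + ⁅connMatrix e a x, connMatrix e b x⁆
      - ∑ c, (christoffel e a c b x - christoffel e b c a x) • connMatrix e c x := by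
  ext p q
  rw [curvMatrix, he.riemann_eq hx]
  simp only [Matrix.sub_apply, Matrix.add_apply, Matrix.sum_apply, Matrix.smul_apply, smul_eq_mul,
    Ring.lie_def, Matrix.mul_apply, Finset.sum_sub_distrib, connMatrix, connMatrixDeriv]
  ring

lemma map_curvMatrix {L : Matrix (Fin 4) (Fin 4) ℝ →ₗ[ℝ] Matrix (Fin 2) (Fin 2) ℂ}
    (hL : ∀ {Ω Ω'}, IsSkew Ω → IsSkew Ω' → L ⁅Ω, Ω'⁆ = ⁅L Ω, L Ω'⁆)
    (he : IsOrthonormalFrame U e) (hx : x ∈ U) (a b : Fin 4) :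
    L (curvMatrix e a b x) = L (connMatrixDeriv e a b x) - L (connMatrixDeriv e b a x)
      + ⁅L (connMatrix e a x), L (connMatrix e b x)⁆
      - ∑ c, ((christoffel e a c b x : ℂ) - christoffel e b c a x) • L (connMatrix e c x) := by
  simp only [he.curvMatrix_eq hx, map_sub, map_add, map_sum, map_smul,
    hL (he.isSkew_connMatrix hx a) (he.isSkew_connMatrix hx b), ← Complex.ofReal_sub,
    Complex.coe_smul]

end IsOrthonormalFrame

end ConnectionMatrices

section SpinConnection

open SpinStructure

variable {M : Type*} [TopologicalSpace M] [ChartedSpace E4 M] [IsManifold (𝓡 4) ∞ M]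
  [Bundle.RiemannianBundle (fun x : M => TangentSpace (𝓡 4) x)]

lemma SpinStructure.isOrthonormalFrame (S : SpinStructure M) (i : S.ι) :
    IsOrthonormalFrame (S.U i) (S.e i) :=
  ⟨S.isOpen_U i, S.smooth_e i, S.orthonormal_e i⟩

variable {S : SpinStructure M} {k n : ℕ}

/-- Smoothness on a set of all the components of a field of spin tensors. -/
def SmoothT (U : Set M) (φ : M → SpinTensor k n) : Prop :=
  ∀ A A', SmoothC U (fun x => φ x A A')

/-- The action of the connection form of the spin connection along `e_c` on spin tensors. -/
def connAct (i : S.ι) (c : Fin 4) (x : M) (T : SpinTensor k n) : SpinTensor k n :=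
  act (spinPlus (connMatrix (S.e i) c x)) (spinMinus (connMatrix (S.e i) c x)) T

/-- The spin curvature of `e_a, e_b` on spin tensors. -/
def curvAct (i : S.ι) (a b : Fin 4) (x : M) (T : SpinTensor k n) : SpinTensor k n :=
  act (spinPlus (curvMatrix (S.e i) a b x)) (spinMinus (curvMatrix (S.e i) a b x)) T

lemma covDeriv_eq (i : S.ι) (c : Fin 4) (φ : M → SpinTensor k n) (x : M) (A : Fin k → Fin 2)
    (A' : Fin n → Fin 2) : covDeriv i c φ x A A' =
      frameDeriv (S.e i) c (fun y => φ y A A') x + connAct i c x (φ x) A A' := by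
  rw [covDeriv, add_assoc]
  rfl

/-- The second covariant derivative `∇²_{c,b} φ`. -/
def hess (i : S.ι) (c b : Fin 4) (φ : M → SpinTensor k n) (x : M) : SpinTensor k n :=
  fun A A' => covDeriv i c (covDeriv i b φ) x A A'
    - ∑ a, (christoffel (S.e i) c a b x : ℂ) * covDeriv i a φ x A A'

variable [IsContMDiffRiemannianBundle (𝓡 4) ∞ E4 (fun x : M => TangentSpace (𝓡 4) x)]

lemma smoothC_map_connMatrix (L : Matrix (Fin 4) (Fin 4) ℝ →ₗ[ℝ] Matrix (Fin 2) (Fin 2) ℂ)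
    (i : S.ι) (c : Fin 4) (A B : Fin 2) :
    SmoothC (S.U i) (fun x => L (connMatrix (S.e i) c x) A B) :=
  smoothC_map_matrix L ((S.isOrthonormalFrame i).contMDiffOn_christoffel c) A B

lemma frameDeriv_map_connMatrix (L : Matrix (Fin 4) (Fin 4) ℝ →ₗ[ℝ] Matrix (Fin 2) (Fin 2) ℂ)
    (i : S.ι) {x : M} (hx : x ∈ S.U i) (a b : Fin 4) (A B : Fin 2) :
    frameDeriv (S.e i) a (fun y => L (connMatrix (S.e i) b y) A B) x =
      L (connMatrixDeriv (S.e i) a b x) A B :=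
  frameDeriv_map_matrix L (S.isOpen_U i) hx
    ((S.isOrthonormalFrame i).contMDiffOn_christoffel b) a A B

lemma SmoothT.connAct {i : S.ι} {φ : M → SpinTensor k n} (hφ : SmoothT (S.U i) φ) (c : Fin 4) :
    SmoothT (S.U i) (fun x => connAct i c x (φ x)) := fun A A' =>
  .add (smoothC_slotAct (smoothC_map_connMatrix spinPlus i c) (fun A => hφ A A') A)
    (smoothC_slotAct (smoothC_map_connMatrix spinMinus i c) (fun A' => hφ A A') A')

lemma SmoothT.covDeriv {i : S.ι} {φ : M → SpinTensor k n} (hφ : SmoothT (S.U i) φ) (c : Fin 4) :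
    SmoothT (S.U i) (covDeriv i c φ) := by
  intro A A'
  simp only [covDeriv_eq]
  exact ((hφ A A').frameDeriv (S.isOrthonormalFrame i) c).add (hφ.connAct c A A')

lemma SmoothT.nabla {i : S.ι} {φ : M → SpinTensor k n} (hφ : SmoothT (S.U i) φ) (B B' : Fin 2) :
    SmoothT (S.U i) (nabla i B B' φ) := fun A A' =>
  .sum fun c _ => .mul (.const _) (hφ.covDeriv c A A')

lemma frameDeriv_connAct (i : S.ι) {x : M} (hx : x ∈ S.U i) {φ : M → SpinTensor k n}
    (hφ : SmoothT (S.U i) φ) (a b : Fin 4) (A : Fin k → Fin 2) (A' : Fin n → Fin 2) :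
    frameDeriv (S.e i) a (fun y => connAct i b y (φ y) A A') x =
      act (spinPlus (connMatrixDeriv (S.e i) a b x)) (spinMinus (connMatrixDeriv (S.e i) a b x))
          (φ x) A A'
      + connAct i b x (fun A A' => frameDeriv (S.e i) a (fun y => φ y A A') x) A A' := by
  have hU := S.isOpen_U i
  have hP := smoothC_map_connMatrix spinPlus i b
  have hQ := smoothC_map_connMatrix spinMinus i b
  simp only [connAct, act]
  rw [frameDeriv_add hU hx a (smoothC_slotAct hP (fun A => hφ A A') A)
      (smoothC_slotAct hQ (fun A' => hφ A A') A'),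
    frameDeriv_slotAct hU hx a hP (fun A => hφ A A') A,
    frameDeriv_slotAct hU hx a hQ (fun A' => hφ A A') A', add_add_add_comm]
  simp only [frameDeriv_map_connMatrix _ i hx]

lemma covDeriv_covDeriv (i : S.ι) {x : M} (hx : x ∈ S.U i) {φ : M → SpinTensor k n}
    (hφ : SmoothT (S.U i) φ) (a b : Fin 4) (A : Fin k → Fin 2) (A' : Fin n → Fin 2) :
    covDeriv i a (covDeriv i b φ) x A A' =
      frameDeriv (S.e i) a (frameDeriv (S.e i) b fun y => φ y A A') x
      + (act (spinPlus (connMatrixDeriv (S.e i) a b x))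
          (spinMinus (connMatrixDeriv (S.e i) a b x)) (φ x) A A'
        + connAct i b x (fun A A' => frameDeriv (S.e i) a (fun y => φ y A A') x) A A')
      + (connAct i a x (fun A A' => frameDeriv (S.e i) b (fun y => φ y A A') x) A A'
        + connAct i a x (connAct i b x (φ x)) A A') := by
  have hcov : covDeriv i b φ = fun y A A' =>
      frameDeriv (S.e i) b (fun y => φ y A A') y + connAct i b y (φ y) A A' := by
    funext y A A'
    exact covDeriv_eq ..
  rw [covDeriv_eq, hcov, frameDeriv_add (S.isOpen_U i) hx a
    ((hφ A A').frameDeriv (S.isOrthonormalFrame i) b) (hφ.connAct b A A'),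
    frameDeriv_connAct i hx hφ]
  exact congrArg _ (act_add ..)

lemma curvAct_eq (i : S.ι) {x : M} (hx : x ∈ S.U i) (a b : Fin 4) (T : SpinTensor k n)
    (A : Fin k → Fin 2) (A' : Fin n → Fin 2) :
    curvAct i a b x T A A' =
      act (spinPlus (connMatrixDeriv (S.e i) a b x)) (spinMinus (connMatrixDeriv (S.e i) a b x))
          T A A'
      - act (spinPlus (connMatrixDeriv (S.e i) b a x)) (spinMinus (connMatrixDeriv (S.e i) b a x))
          T A A'
      + (connAct i a x (connAct i b x T) A A' - connAct i b x (connAct i a x T) A A')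
      - ∑ c, ((christoffel (S.e i) a c b x : ℂ) - christoffel (S.e i) b c a x)
          * connAct i c x T A A' := by
  have he := S.isOrthonormalFrame i
  have hcomm : connAct i a x (connAct i b x T) A A' - connAct i b x (connAct i a x T) A A' =
      act ⁅spinPlus (connMatrix (S.e i) a x), spinPlus (connMatrix (S.e i) b x)⁆
        ⁅spinMinus (connMatrix (S.e i) a x), spinMinus (connMatrix (S.e i) b x)⁆ T A A' :=
    act_commutator ..
  rw [hcomm, curvAct, he.map_curvMatrix spinPlus_lie hx, he.map_curvMatrix spinMinus_lie hx]
  simp only [connAct, act, sub_slotAct, add_slotAct, sum_slotAct, smul_slotAct,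
    mul_add, Finset.sum_add_distrib]
  ring

/-- The Ricci identity for spin tensors. -/
lemma hess_sub_hess (i : S.ι) {x : M} (hx : x ∈ S.U i) {φ : M → SpinTensor k n}
    (hφ : SmoothT (S.U i) φ) (a b : Fin 4) (A : Fin k → Fin 2) (A' : Fin n → Fin 2) :
    hess i a b φ x A A' - hess i b a φ x A A' = curvAct i a b x (φ x) A A' := by
  have hcomm := frameDeriv_comm (S.isOrthonormalFrame i) hx (hφ A A') a b
  have hsum : ∑ c, (christoffel (S.e i) a c b x : ℂ) * covDeriv i c φ x A A'
      - ∑ c, (christoffel (S.e i) b c a x : ℂ) * covDeriv i c φ x A A' =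
      ∑ c, ((christoffel (S.e i) a c b x : ℂ) - christoffel (S.e i) b c a x) *
        frameDeriv (S.e i) c (fun y => φ y A A') x
      + ∑ c, ((christoffel (S.e i) a c b x : ℂ) - christoffel (S.e i) b c a x) *
        connAct i c x (φ x) A A' := by
    simp only [← Finset.sum_sub_distrib, ← Finset.sum_add_distrib, covDeriv_eq]
    exact Finset.sum_congr rfl fun c _ => by ring
  rw [hess, hess, covDeriv_covDeriv i hx hφ, covDeriv_covDeriv i hx hφ, curvAct_eq i hx]
  linear_combination hcomm - hsum

end SpinConnection

section Symmetrisation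

open Function

lemma sum_eps_invariant {Q : Matrix (Fin 2) (Fin 2) ℂ} (hQ : Q.trace = 0)
    (N : Fin 2 → Fin 2 → ℂ) :
    ∑ B, ∑ C, eps B C * (∑ X, Q B X * N X C + ∑ X, Q C X * N B X) = 0 := by
  rw [Matrix.trace_fin_two] at hQ
  simp only [Fin.sum_univ_two, eps, Matrix.of_apply, Matrix.cons_val_zero, Matrix.cons_val_one,
    Matrix.cons_val', Matrix.cons_val_fin_one]
  linear_combination (N 0 1 - N 1 0) * hQ

lemma sum_eps_mul_sub_swap (K : Fin 2 → Fin 2 → Fin 2 → ℂ) (X : Fin 2) :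
    ∑ B, ∑ C, eps B C * (K X B C - K B X C) = -∑ B, ∑ C, eps B C * K B C X := by
  fin_cases X <;> simp [Fin.sum_univ_two, eps] <;> ring

lemma slotAct_comp_perm {R ι α : Type*} [CommRing R] [Fintype ι] [DecidableEq ι] [Fintype α]
    (P : Matrix α α R) (T : (ι → α) → R) (s : Equiv.Perm ι) (A : ι → α) :
    slotAct P T (A ∘ s) = slotAct P (fun A => T (A ∘ s)) A :=
  Fintype.sum_equiv s _ _ fun m => by
    simp only [slotActAt, comp_apply, update_comp_equiv, Equiv.symm_apply_apply]

section Snoc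

variable {α : Type*} {n : ℕ}

lemma exists_perm_snoc_succAbove (r : Fin (n + 1)) : ∃ t : Equiv.Perm (Fin (n + 1)),
    ∀ A : Fin (n + 1) → α,
      Fin.snoc (α := fun _ => α) (fun m => A (r.succAbove m)) (A r) = A ∘ t := by
  refine ⟨(finSuccEquiv' (Fin.last n)).trans (finSuccEquiv' r).symm, fun A => funext fun m => ?_⟩
  refine Fin.lastCases ?_ (fun m => ?_) m
  · simp
  · simp [finSuccEquiv'_last_apply_castSucc]

lemma snoc_succAbove_castSucc (A : Fin (n + 1) → α) (C : α) (r : Fin (n + 1)) :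
    (fun m => Fin.snoc (α := fun _ => α) A C (r.castSucc.succAbove m)) =
      Fin.snoc (α := fun _ => α) (fun m => A (r.succAbove m)) C := by
  funext m
  refine Fin.lastCases ?_ (fun m => ?_) m
  · rw [Fin.succAbove_castSucc_of_le _ _ (Fin.le_last r), Fin.succ_last, Fin.snoc_last,
      Fin.snoc_last]
  · rw [Fin.castSucc_succAbove_castSucc, Fin.snoc_castSucc, Fin.snoc_castSucc]

end Snoc

variable {k n : ℕ} (P Q : Matrix (Fin 2) (Fin 2) ℂ)

/-- The derivation action of a pair of matrices on spin tensors with two further spinor indices,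
one unprimed and one primed. -/
def actPair (F : Fin 2 → Fin 2 → SpinTensor k n) (B B' : Fin 2) : SpinTensor k n :=
  fun A A' => ∑ X, P B X * F X B' A A' + ∑ X, Q B' X * F B X A A' + act P Q (F B B') A A'

/-- The unnormalised symmetrisation of a spin tensor over the positions of two further indices, as
in `d`. -/
def symInsert (F : Fin 2 → Fin 2 → SpinTensor k n) : SpinTensor (k + 1) (n + 1) :=
  fun A A' => ∑ p : Fin (k + 1), ∑ r : Fin (n + 1),
    F (A p) (A' r) (fun m => A (p.succAbove m)) (fun m => A' (r.succAbove m))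

/-- The unnormalised symmetrisation over the positions of a further unprimed index, and the
contraction of a further primed index with the last one, as in `δ`. -/
def symContract (F : Fin 2 → Fin 2 → SpinTensor k (n + 1)) : SpinTensor (k + 1) n :=
  fun A A' => ∑ p : Fin (k + 1), ∑ B', ∑ C',
    eps B' C' * F (A p) B' (fun m => A (p.succAbove m)) (Fin.snoc A' C')

lemma act_symInsert (F : Fin 2 → Fin 2 → SpinTensor k n) (A : Fin (k + 1) → Fin 2)
    (A' : Fin (n + 1) → Fin 2) :
    act P Q (symInsert F) A A' = symInsert (actPair P Q F) A A' := by
  have hplus : slotAct P (fun A => symInsert F A A') A = ∑ p : Fin (k + 1), ∑ r : Fin (n + 1),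
      (∑ X, P (A p) X * F X (A' r) (fun m => A (p.succAbove m)) (fun m => A' (r.succAbove m))
        + slotAct P (fun a => F (A p) (A' r) a (fun m => A' (r.succAbove m)))
          (fun m => A (p.succAbove m))) := by
    refine (slotAct_insert P (fun X a => ∑ r : Fin (n + 1),
      F X (A' r) a (fun m => A' (r.succAbove m))) A).trans (Finset.sum_congr rfl fun p _ => ?_)
    rw [slotAct_sum, Finset.sum_add_distrib]
    simp only [Finset.mul_sum]
    rw [Finset.sum_comm]
  have hminus : slotAct Q (symInsert F A) A' = ∑ p : Fin (k + 1), ∑ r : Fin (n + 1),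
      (∑ X, Q (A' r) X * F (A p) X (fun m => A (p.succAbove m)) (fun m => A' (r.succAbove m))
        + slotAct Q (F (A p) (A' r) (fun m => A (p.succAbove m))) (fun m => A' (r.succAbove m))) :=
    (slotAct_sum Q A' _ _).trans (Finset.sum_congr rfl fun p _ =>
      slotAct_insert Q (fun X => F (A p) X fun m => A (p.succAbove m)) A')
  rw [act, hplus, hminus]
  simp only [← Finset.sum_add_distrib, symInsert, actPair, act, add_add_add_comm]

/-- The trace condition makes `ε` invariant, so that the contraction commutes with the action. -/
lemma act_symContract (hQ : Q.trace = 0) (F : Fin 2 → Fin 2 → SpinTensor k (n + 1))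
    (A : Fin (k + 1) → Fin 2) (A' : Fin n → Fin 2) :
    act P Q (symContract F) A A' = symContract (actPair P Q F) A A' := by
  have hplus : slotAct P (fun A => symContract F A A') A = ∑ p : Fin (k + 1), ∑ B', ∑ C',
      eps B' C' * (∑ X, P (A p) X * F X B' (fun m => A (p.succAbove m)) (Fin.snoc A' C')
        + slotAct P (fun a => F (A p) B' a (Fin.snoc A' C')) (fun m => A (p.succAbove m))) := by
    refine (slotAct_insert P (fun X a => ∑ B', ∑ C', eps B' C' * F X B' a (Fin.snoc A' C'))
      A).trans (Finset.sum_congr rfl fun p _ => ?_)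
    simp only [slotAct_sum, slotAct_const_mul, mul_add, Finset.sum_add_distrib]
    congr 1
    simp only [Fin.sum_univ_two]
    ring
  have hminus : slotAct Q (symContract F A) A' = ∑ p : Fin (k + 1), ∑ B', ∑ C', eps B' C' *
      (∑ X, Q B' X * F (A p) X (fun m => A (p.succAbove m)) (Fin.snoc A' C')
        + slotAct Q (F (A p) B' (fun m => A (p.succAbove m))) (Fin.snoc A' C')) := by
    have hsum : slotAct Q (symContract F A) A' = ∑ p : Fin (k + 1), ∑ B', ∑ C', eps B' C' *
        slotAct Q (fun A' => F (A p) B' (fun m => A (p.succAbove m)) (Fin.snoc A' C')) A' := by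
      simp only [← slotAct_const_mul, ← slotAct_sum]
      rfl
    rw [hsum]
    refine Finset.sum_congr rfl fun p _ => ?_
    rw [← add_zero (∑ B', ∑ C', _), ← sum_eps_invariant hQ fun B' C' =>
      F (A p) B' (fun m => A (p.succAbove m)) (Fin.snoc A' C')]
    simp only [← Finset.sum_add_distrib, ← slotAct_snoc]
    refine Finset.sum_congr rfl fun B' _ => Finset.sum_congr rfl fun C' _ => ?_
    rw [Finset.sum_add_distrib]
    ring
  rw [act, hplus, hminus]
  simp only [← Finset.sum_add_distrib, ← mul_add, symContract, actPair, act, add_add_add_comm]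

end Symmetrisation

section Commutator

open SpinStructure

section SymmetrisationDerivative

variable {M : Type*} [TopologicalSpace M] [ChartedSpace E4 M] {U : Set M} {x : M}
  {e : Fin 4 → Π x : M, TangentSpace (𝓡 4) x} {k n : ℕ}

lemma frameDeriv_symInsert (hU : IsOpen U) (hx : x ∈ U) (c : Fin 4)
    {F : M → Fin 2 → Fin 2 → SpinTensor k n}
    (hF : ∀ B B' A A', SmoothC U (fun y => F y B B' A A')) (A : Fin (k + 1) → Fin 2)
    (A' : Fin (n + 1) → Fin 2) :
    frameDeriv e c (fun y => symInsert (F y) A A') x =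
      symInsert (fun B B' A A' => frameDeriv e c (fun y => F y B B' A A') x) A A' := by
  simp only [symInsert]
  rw [frameDeriv_sum hU hx c fun p _ => .sum fun r _ => hF _ _ _ _]
  exact Finset.sum_congr rfl fun p _ => frameDeriv_sum hU hx c fun r _ => hF _ _ _ _

lemma frameDeriv_symContract (hU : IsOpen U) (hx : x ∈ U) (c : Fin 4)
    {F : M → Fin 2 → Fin 2 → SpinTensor k (n + 1)}
    (hF : ∀ B B' A A', SmoothC U (fun y => F y B B' A A')) (A : Fin (k + 1) → Fin 2)
    (A' : Fin n → Fin 2) :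
    frameDeriv e c (fun y => symContract (F y) A A') x =
      symContract (fun B B' A A' => frameDeriv e c (fun y => F y B B' A A') x) A A' := by
  have hterm : ∀ p B' C', SmoothC U (fun y =>
      eps B' C' * F y (A p) B' (fun m => A (p.succAbove m)) (Fin.snoc A' C')) :=
    fun p B' C' => .mul (.const _) (hF _ _ _ _)
  simp only [symContract]
  rw [frameDeriv_sum hU hx c fun p _ => .sum fun B' _ => .sum fun C' _ => hterm p B' C']
  refine Finset.sum_congr rfl fun p _ => ?_
  rw [frameDeriv_sum hU hx c fun B' _ => .sum fun C' _ => hterm p B' C']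
  refine Finset.sum_congr rfl fun B' _ => ?_
  rw [frameDeriv_sum hU hx c fun C' _ => hterm p B' C']
  exact Finset.sum_congr rfl fun C' _ => frameDeriv_const_mul hU hx c (hF _ _ _ _) _

end SymmetrisationDerivative

variable {M : Type*} [TopologicalSpace M] [ChartedSpace E4 M] [IsManifold (𝓡 4) ∞ M]
  [Bundle.RiemannianBundle (fun x : M => TangentSpace (𝓡 4) x)]
  {S : SpinStructure M} {k n : ℕ}

/-- The second covariant derivative `∇_c ∇_{BB'} φ`, in which one of the two vector indices is
written as a pair of spinor indices. -/
def solderHess (i : S.ι) (c : Fin 4) (φ : M → SpinTensor k n) (x : M) (B B' : Fin 2) :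
    SpinTensor k n :=
  fun A A' => ∑ b, soldering b B B' * hess i c b φ x A A'

/-- The second covariant derivative `∇_{XX'} ∇_{YY'} φ`, with spinor indices. -/
def spinorHess (i : S.ι) (φ : M → SpinTensor k n) (x : M) (X X' Y Y' : Fin 2) : SpinTensor k n :=
  fun A A' => ∑ c, soldering c X X' * solderHess i c φ x Y Y' A A'

/-- The part of `∇_A^{X'} ∇_B^{Y'} φ` symmetrised over the unprimed indices, unnormalised. -/
def hessPair (i : S.ι) (φ : M → SpinTensor k n) (x : M) (A : Fin (k + 2) → Fin 2) (X' Y' : Fin 2)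
    (A' : Fin n → Fin 2) : ℂ :=
  ∑ p : Fin (k + 2), ∑ q : Fin (k + 1), spinorHess i φ x (A p) X' (A (p.succAbove q)) Y'
    (fun m => A (p.succAbove (q.succAbove m))) A'

/-- The spin curvature, projected to `S₊²` in its form indices, acting on a spin tensor and
symmetrised over the unprimed indices, unnormalised. -/
def curvPair (i : S.ι) (x : M) (T : SpinTensor k n) : SpinTensor (k + 2) n :=
  fun A A' => ∑ p : Fin (k + 2), ∑ q : Fin (k + 1), ∑ c, ∑ b,
    solderPair c b (A p) (A (p.succAbove q)) *
      curvAct i c b x T (fun m => A (p.succAbove (q.succAbove m))) A'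

lemma curvPair_comp_perm (i : S.ι) (x : M) {T : SpinTensor k n} (t : Equiv.Perm (Fin n))
    (hT : ∀ A A', T A (A' ∘ t) = T A A') (A : Fin (k + 2) → Fin 2) (A' : Fin n → Fin 2) :
    curvPair i x T A (A' ∘ t) = curvPair i x T A A' := by
  simp only [curvPair, curvAct, act, slotAct_comp_perm, hT]

lemma SpinorField.smoothT (ψ : SpinorField S k n) (i : S.ι) : SmoothT (S.U i) (ψ.comp i) :=
  fun A A' => ψ.smooth i A A'

lemma connAct_nabla (i : S.ι) (x : M) (φ : M → SpinTensor k n) (c : Fin 4) (B B' : Fin 2)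
    (A : Fin k → Fin 2) (A' : Fin n → Fin 2) :
    connAct i c x (nabla i B B' φ x) A A' =
      ∑ b, soldering b B B' * connAct i c x (covDeriv i b φ x) A A' := by
  simp only [connAct, act, mul_add, Finset.sum_add_distrib, ← slotAct_const_mul]
  rw [← slotAct_sum, ← slotAct_sum]
  rfl

variable [IsContMDiffRiemannianBundle (𝓡 4) ∞ E4 (fun x : M => TangentSpace (𝓡 4) x)]

lemma connection_nabla (i : S.ι) {x : M} (hx : x ∈ S.U i) (φ : M → SpinTensor k n) (c : Fin 4)
    (B B' : Fin 2) (A : Fin k → Fin 2) (A' : Fin n → Fin 2) :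
    ∑ X, spinPlus (connMatrix (S.e i) c x) B X * nabla i X B' φ x A A'
      + ∑ X, spinMinus (connMatrix (S.e i) c x) B' X * nabla i B X φ x A A' =
    -∑ b, soldering b B B' * ∑ a, (christoffel (S.e i) c a b x : ℂ) * covDeriv i a φ x A A' := by
  have he := S.isOrthonormalFrame i
  calc ∑ X, spinPlus (connMatrix (S.e i) c x) B X * nabla i X B' φ x A A'
        + ∑ X, spinMinus (connMatrix (S.e i) c x) B' X * nabla i B X φ x A A'
      = ∑ b, ∑ a, (christoffel (S.e i) c a b x : ℂ) * soldering a B B' * covDeriv i b φ x A A' := by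
        simp only [nabla, Finset.mul_sum]
        rw [Finset.sum_comm, add_comm, Finset.sum_comm, add_comm, ← Finset.sum_add_distrib]
        refine Finset.sum_congr rfl fun b _ => ?_
        simp only [← mul_assoc, ← Finset.sum_mul]
        rw [← add_mul, spin_soldering (he.isSkew_connMatrix hx c) b B B']
        rfl
    _ = -∑ b, soldering b B B' *
          ∑ a, (christoffel (S.e i) c a b x : ℂ) * covDeriv i a φ x A A' := by
        simp only [Finset.mul_sum, ← Finset.sum_neg_distrib]
        rw [Finset.sum_comm]
        refine Finset.sum_congr rfl fun b _ => Finset.sum_congr rfl fun a _ => ?_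
        rw [he.christoffel_skew hx c b a]
        push_cast
        ring

lemma frameDeriv_nabla (i : S.ι) {x : M} (hx : x ∈ S.U i) {φ : M → SpinTensor k n}
    (hφ : SmoothT (S.U i) φ) (c : Fin 4) (B B' : Fin 2) (A : Fin k → Fin 2)
    (A' : Fin n → Fin 2) :
    frameDeriv (S.e i) c (fun y => nabla i B B' φ y A A') x =
      ∑ b, soldering b B B' * frameDeriv (S.e i) c (fun y => covDeriv i b φ y A A') x := by
  simp only [nabla]
  rw [frameDeriv_sum (S.isOpen_U i) hx c fun b _ => .mul (.const _) (hφ.covDeriv b A A')]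
  exact Finset.sum_congr rfl fun b _ =>
    frameDeriv_const_mul (S.isOpen_U i) hx c (hφ.covDeriv b A A') _

/-- The soldering form is parallel. -/
lemma frameDeriv_nabla_add_actPair (i : S.ι) {x : M} (hx : x ∈ S.U i) {φ : M → SpinTensor k n}
    (hφ : SmoothT (S.U i) φ) (c : Fin 4) (B B' : Fin 2) (A : Fin k → Fin 2)
    (A' : Fin n → Fin 2) :
    frameDeriv (S.e i) c (fun y => nabla i B B' φ y A A') x
      + actPair (spinPlus (connMatrix (S.e i) c x)) (spinMinus (connMatrix (S.e i) c x))
          (fun B B' => nabla i B B' φ x) B B' A A' =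
    solderHess i c φ x B B' A A' := by
  have hact := connAct_nabla i x φ c B B' A A'
  have hcov : ∑ b, soldering b B B' * covDeriv i c (covDeriv i b φ) x A A' =
      ∑ b, soldering b B B' * frameDeriv (S.e i) c (fun y => covDeriv i b φ y A A') x
      + ∑ b, soldering b B B' * connAct i c x (covDeriv i b φ x) A A' := by
    simp only [covDeriv_eq i c (covDeriv i _ φ), mul_add, Finset.sum_add_distrib]
  rw [connAct] at hact
  simp only [solderHess, hess, mul_sub, Finset.sum_sub_distrib]
  rw [actPair, connection_nabla i hx φ c B B' A A', hact, frameDeriv_nabla i hx hφ, hcov]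
  ring

lemma covDeriv_dOp (i : S.ι) {x : M} (hx : x ∈ S.U i) {φ : M → SpinTensor k n}
    (hφ : SmoothT (S.U i) φ) (c : Fin 4) (A : Fin (k + 1) → Fin 2) (A' : Fin (n + 1) → Fin 2) :
    covDeriv i c (dOp i φ) x A A' = symInsert (solderHess i c φ x) A A' := by
  have hderiv : frameDeriv (S.e i) c (fun y => dOp i φ y A A') x =
      symInsert (fun B B' A A' => frameDeriv (S.e i) c (fun y => nabla i B B' φ y A A') x) A A' :=
    frameDeriv_symInsert (S.isOpen_U i) hx c (fun B B' => hφ.nabla B B') A A'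
  have hact : connAct i c x (dOp i φ x) A A' = symInsert (actPair
      (spinPlus (connMatrix (S.e i) c x)) (spinMinus (connMatrix (S.e i) c x))
      fun B B' => nabla i B B' φ x) A A' :=
    act_symInsert _ _ (fun B B' => nabla i B B' φ x) A A'
  rw [covDeriv_eq, hderiv, hact]
  simp only [symInsert, ← Finset.sum_add_distrib, frameDeriv_nabla_add_actPair i hx hφ]

lemma covDeriv_deltaOp (i : S.ι) {x : M} (hx : x ∈ S.U i) {φ : M → SpinTensor k (n + 1)}
    (hφ : SmoothT (S.U i) φ) (c : Fin 4) (A : Fin (k + 1) → Fin 2) (A' : Fin n → Fin 2) :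
    covDeriv i c (deltaOp i φ) x A A' = symContract (solderHess i c φ x) A A' := by
  have hderiv : frameDeriv (S.e i) c (fun y => deltaOp i φ y A A') x =
      symContract (fun B B' A A' => frameDeriv (S.e i) c (fun y => nabla i B B' φ y A A') x)
        A A' :=
    frameDeriv_symContract (S.isOpen_U i) hx c (fun B B' => hφ.nabla B B') A A'
  have hact : connAct i c x (deltaOp i φ x) A A' = symContract (actPair
      (spinPlus (connMatrix (S.e i) c x)) (spinMinus (connMatrix (S.e i) c x))
      fun B B' => nabla i B B' φ x) A A' :=
    act_symContract _ _ (trace_spinMinus ((S.isOrthonormalFrame i).isSkew_connMatrix hx c))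
      (fun B B' => nabla i B B' φ x) A A'
  rw [covDeriv_eq, hderiv, hact]
  simp only [symContract, ← Finset.sum_add_distrib, ← mul_add,
    frameDeriv_nabla_add_actPair i hx hφ]

lemma nabla_dOp (i : S.ι) {x : M} (hx : x ∈ S.U i) {φ : M → SpinTensor k n}
    (hφ : SmoothT (S.U i) φ) (X X' : Fin 2) (A : Fin (k + 1) → Fin 2)
    (A' : Fin (n + 1) → Fin 2) :
    nabla i X X' (dOp i φ) x A A' = symInsert (spinorHess i φ x X X') A A' := by
  simp only [nabla, covDeriv_dOp i hx hφ, symInsert, spinorHess, Finset.mul_sum]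
  rw [Finset.sum_comm]
  exact Finset.sum_congr rfl fun p _ => Finset.sum_comm

lemma nabla_deltaOp (i : S.ι) {x : M} (hx : x ∈ S.U i) {φ : M → SpinTensor k (n + 1)}
    (hφ : SmoothT (S.U i) φ) (X X' : Fin 2) (A : Fin (k + 1) → Fin 2) (A' : Fin n → Fin 2) :
    nabla i X X' (deltaOp i φ) x A A' = symContract (spinorHess i φ x X X') A A' := by
  simp only [nabla, covDeriv_deltaOp i hx hφ, symContract, spinorHess, Finset.mul_sum]
  rw [Finset.sum_comm]
  refine Finset.sum_congr rfl fun p _ => ?_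
  rw [Finset.sum_comm]
  refine Finset.sum_congr rfl fun B _ => ?_
  rw [Finset.sum_comm]
  exact Finset.sum_congr rfl fun C _ => Finset.sum_congr rfl fun c _ => mul_left_comm _ _ _

lemma dOp_deltaOp (i : S.ι) {x : M} (hx : x ∈ S.U i) {φ : M → SpinTensor k (n + 1)}
    (hφ : SmoothT (S.U i) φ) (A : Fin (k + 2) → Fin 2) (A' : Fin (n + 1) → Fin 2) :
    dOp i (deltaOp i φ) x A A' = ∑ r, ∑ B, ∑ C, eps B C *
      hessPair i φ x A (A' r) B (Fin.snoc (fun m => A' (r.succAbove m)) C) := by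
  simp only [dOp, nabla_deltaOp i hx hφ, symContract, hessPair]
  rw [Finset.sum_comm]
  refine Finset.sum_congr rfl fun r _ => ?_
  simp only [Fin.sum_univ_two, Finset.sum_add_distrib, ← Finset.mul_sum]

lemma deltaOp_dOp (i : S.ι) {x : M} (hx : x ∈ S.U i) {φ : M → SpinTensor k n}
    (hφ : SmoothT (S.U i) φ) (A : Fin (k + 2) → Fin 2) (A' : Fin n → Fin 2) :
    deltaOp i (dOp i φ) x A A' = ∑ r, ∑ B, ∑ C, eps B C *
      hessPair i φ x A B ((Fin.snoc A' C : Fin (n + 1) → Fin 2) r)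
        (fun m => (Fin.snoc A' C : Fin (n + 1) → Fin 2) (r.succAbove m)) := by
  have sum_rotate : ∀ H : Fin (k + 2) → Fin (k + 1) → Fin (n + 1) → ℂ,
      ∑ p, ∑ q, ∑ r, H p q r = ∑ r, ∑ p, ∑ q, H p q r := fun H =>
    (Finset.sum_congr rfl fun p _ => Finset.sum_comm).trans Finset.sum_comm
  simp only [deltaOp, nabla_dOp i hx hφ, symInsert, hessPair]
  simp only [Fin.sum_univ_two, Finset.sum_add_distrib, ← Finset.mul_sum, sum_rotate]

/-- Exchanging the two symmetrised unprimed indices turns the second derivatives into a commutator,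
to which the Ricci identity applies. -/
lemma sum_eps_hessPair (i : S.ι) {x : M} (hx : x ∈ S.U i) {φ : M → SpinTensor k n}
    (hφ : SmoothT (S.U i) φ) (A : Fin (k + 2) → Fin 2) (A' : Fin n → Fin 2) :
    ∑ B, ∑ C, eps B C * hessPair i φ x A B C A' = (1 / 2) * curvPair i x (φ x) A A' := by
  have hpair : ∑ B, ∑ C, eps B C * hessPair i φ x A B C A' =
      ∑ p : Fin (k + 2), ∑ q : Fin (k + 1), ∑ c, ∑ b,
        solderPair c b (A p) (A (p.succAbove q)) *
          hess i c b φ x (fun m => A (p.succAbove (q.succAbove m))) A' := by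
    simp only [hessPair, spinorHess, solderHess, solderPair, Fin.sum_univ_two, Finset.mul_sum,
      add_mul, Finset.sum_add_distrib, mul_assoc]
  have hexchange := sum_removeNth_swap (fun P Q a => ∑ c, ∑ b, solderPair c b P Q *
    hess i c b φ x a A') A
  have hskew : ∑ p : Fin (k + 2), ∑ q : Fin (k + 1), ∑ c, ∑ b,
        solderPair c b (A (p.succAbove q)) (A p) *
          hess i c b φ x (fun m => A (p.succAbove (q.succAbove m))) A' =
      -∑ p : Fin (k + 2), ∑ q : Fin (k + 1), ∑ c, ∑ b,
        solderPair c b (A p) (A (p.succAbove q)) *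
          hess i b c φ x (fun m => A (p.succAbove (q.succAbove m))) A' := by
    simp only [← Finset.sum_neg_distrib]
    refine Finset.sum_congr rfl fun p _ => Finset.sum_congr rfl fun q _ => ?_
    rw [Finset.sum_comm]
    refine Finset.sum_congr rfl fun c _ => Finset.sum_congr rfl fun b _ => ?_
    rw [solderPair_swap, neg_mul]
  have hcurv : curvPair i x (φ x) A A' =
      ∑ p : Fin (k + 2), ∑ q : Fin (k + 1), ∑ c, ∑ b,
        solderPair c b (A p) (A (p.succAbove q)) *
          hess i c b φ x (fun m => A (p.succAbove (q.succAbove m))) A'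
      - ∑ p : Fin (k + 2), ∑ q : Fin (k + 1), ∑ c, ∑ b,
        solderPair c b (A p) (A (p.succAbove q)) *
          hess i b c φ x (fun m => A (p.succAbove (q.succAbove m))) A' := by
    simp only [curvPair, ← hess_sub_hess i hx hφ, mul_sub, Finset.sum_sub_distrib]
  linear_combination hpair + (1 / 2) * hexchange + (1 / 2) * hskew - (1 / 2) * hcurv

lemma deltaOp_dOp_zero (i : S.ι) {x : M} (hx : x ∈ S.U i) {φ : M → SpinTensor k 0}
    (hφ : SmoothT (S.U i) φ) (A : Fin (k + 2) → Fin 2) (A' : Fin 0 → Fin 2) :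
    deltaOp i (dOp i φ) x A A' = (1 / 2) * curvPair i x (φ x) A A' := by
  rw [deltaOp_dOp i hx hφ, ← sum_eps_hessPair i hx hφ, Fin.sum_univ_one]
  refine Finset.sum_congr rfl fun B _ => Finset.sum_congr rfl fun C _ => ?_
  congr 2
  exact Subsingleton.elim _ _

lemma sum_eps_hessPair_sub_swap (i : S.ι) {x : M} (hx : x ∈ S.U i) {φ : M → SpinTensor k (n + 1)}
    (hφ : SmoothT (S.U i) φ)
    (hsymm : ∀ (t : Equiv.Perm (Fin (n + 1))) A A', φ x A (A' ∘ t) = φ x A A')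
    (A : Fin (k + 2) → Fin 2) (A' : Fin (n + 1) → Fin 2) (r : Fin (n + 1)) :
    (∑ B, ∑ C, eps B C *
        hessPair i φ x A (A' r) B (Fin.snoc (fun m => A' (r.succAbove m)) C)) -
      (∑ B, ∑ C, eps B C *
        hessPair i φ x A B (A' r) (Fin.snoc (fun m => A' (r.succAbove m)) C)) =
      -((1 / 2) * curvPair i x (φ x) A A') := by
  have hswap := sum_eps_mul_sub_swap (fun X Y C => hessPair i φ x A X Y
    (Fin.snoc (fun m => A' (r.succAbove m)) C)) (A' r)
  simp only [mul_sub, Finset.sum_sub_distrib] at hswap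
  obtain ⟨t, ht⟩ := exists_perm_snoc_succAbove (α := Fin 2) r
  rw [hswap, sum_eps_hessPair i hx hφ, ht, curvPair_comp_perm i x t (hsymm t)]

lemma dOp_deltaOp_sub_deltaOp_dOp (i : S.ι) {x : M} (hx : x ∈ S.U i)
    {φ : M → SpinTensor k (n + 1)} (hφ : SmoothT (S.U i) φ)
    (hsymm : ∀ (t : Equiv.Perm (Fin (n + 1))) A A', φ x A (A' ∘ t) = φ x A A')
    (A : Fin (k + 2) → Fin 2) (A' : Fin (n + 1) → Fin 2) :
    dOp i (deltaOp i φ) x A A' - deltaOp i (dOp i φ) x A A' =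
      -((n + 2) / 2) * curvPair i x (φ x) A A' := by
  rw [dOp_deltaOp i hx hφ, deltaOp_dOp i hx hφ, Fin.sum_univ_castSucc (n := n + 1)]
  simp only [Fin.snoc_last, Fin.snoc_castSucc, Fin.succAbove_last, snoc_succAbove_castSucc]
  rw [sum_eps_hessPair i hx hφ, ← sub_sub, ← Finset.sum_sub_distrib,
    Finset.sum_congr rfl fun r _ => sum_eps_hessPair_sub_swap i hx hφ hsymm A A' r,
    Finset.sum_const, Finset.card_univ, Fintype.card_fin, nsmul_eq_mul]
  push_cast
  ring

/-- `dδ - δd` is an operator of order zero. -/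
lemma commutesOn_iff (S : SpinStructure M) (k n : ℕ) : S.CommutesOn k n ↔
    ∀ ψ : SpinorField S k n, ∀ i, ∀ x ∈ S.U i, curvPair i x (ψ.comp i x) = 0 := by
  cases n with
  | zero =>
    refine forall_congr' fun ψ => forall_congr' fun i => forall₂_congr fun x hx => ?_
    simp only [funext_iff, Pi.zero_apply, deltaOp_dOp_zero i hx (ψ.smoothT i)]
    simp
  | succ n =>
    have hn : -(((n : ℂ) + 2) / 2) ≠ 0 :=
      neg_ne_zero.2 (div_ne_zero (by exact_mod_cast (n + 1).succ_ne_zero) two_ne_zero)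
    refine forall_congr' fun ψ => forall_congr' fun i => forall₂_congr fun x hx => ?_
    have hsymm : ∀ (t : Equiv.Perm (Fin (n + 1))) A A',
        ψ.comp i x A (A' ∘ t) = ψ.comp i x A A' :=
      ψ.symm i x hx 1
    simp only [funext_iff, Pi.zero_apply, Pi.sub_apply,
      dOp_deltaOp_sub_deltaOp_dOp i hx (ψ.smoothT i) hsymm, mul_eq_zero_iff_left hn]

end Commutator

section CurvatureBlocks

/-- The element of `S₊² ⊗ End S₊` (or of `S₊² ⊗ End S₋`) whose matrix in the bases given by the
imaginary quaternions is `-b`; the sign is the one that makes `b` a block of the curvature. -/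
def spinBlock (b : Matrix (Fin 3) (Fin 3) ℝ) (P Q : Fin 2) : Matrix (Fin 2) (Fin 2) ℂ :=
  -∑ j, (∑ i, (b i j : ℂ) * soldering i.succ P Q) • quat j.succ

lemma spinBlock_zero (P Q : Fin 2) : spinBlock 0 P Q = 0 := by
  simp [spinBlock]

lemma spinBlock_smul_one (r : ℝ) (P Q A B : Fin 2) : spinBlock (r • 1) P Q A B =
    -(r : ℂ) * (eps P A * (1 : Matrix (Fin 2) (Fin 2) ℂ) Q B
      + eps Q A * (1 : Matrix (Fin 2) (Fin 2) ℂ) P B) := by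
  simp only [spinBlock, Fin.sum_univ_three, soldering, Matrix.neg_apply, Matrix.add_apply,
    Matrix.smul_apply, Matrix.mul_apply, Fin.sum_univ_two]
  fin_cases P <;> fin_cases Q <;> fin_cases A <;> fin_cases B <;>
    simp [quat, eps] <;> ring_nf <;> simp only [Complex.I_sq] <;> ring

lemma sum_solderPair_smul_imQuat {F : Fin 4 → Fin 4 → Fin 3 → ℝ} (hF : ∀ c b, F c b = -F b c)
    (P Q : Fin 2) :
    ∑ c, ∑ b, solderPair c b P Q • -((1 / 2 : ℂ) • imQuat (F c b)) =
      spinBlock (.of fun i j => sdPart (fun c b => F c b j) i) P Q := by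
  have hskew : ∀ j, IsSkew fun c b => F c b j := fun j c b => congrFun (hF c b) j
  have hsum : ∀ j, ∑ i, (sdPart (fun c b => F c b j) i : ℂ) * soldering i.succ P Q =
      ∑ c, ∑ b, solderPair c b P Q * ((1 / 2) * F c b j) := by
    intro j
    simp only [mul_left_comm _ (1 / 2 : ℂ), ← Finset.mul_sum, sum_solderPair (hskew j)]
    ring
  simp only [spinBlock, Matrix.of_apply, hsum, imQuat, Finset.smul_sum, smul_smul, smul_neg,
    Finset.sum_neg_distrib, Finset.sum_smul]
  rw [Finset.sum_comm_cycle]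

end CurvatureBlocks

section SymmetricTensors

variable {α : Type*} {k : ℕ}

lemma update_eq_cons_comp_cycleRange (A : Fin (k + 1) → α) (m : Fin (k + 1)) (B : α) :
    Function.update A m B =
      Fin.cons (α := fun _ => α) B (fun j => A (m.succAbove j)) ∘ m.cycleRange := by
  rw [Fin.cons_comp_cycleRange]
  exact (Fin.insertNth_removeNth m B A).symm

lemma slotAct_of_symm [Fintype α] {R : Type*} [CommRing R] (P : Matrix α α R)
    {T : (Fin (k + 1) → α) → R} (hT : ∀ (t : Equiv.Perm (Fin (k + 1))) A, T (A ∘ t) = T A)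
    (A : Fin (k + 1) → α) :
    slotAct P T A = ∑ m, ∑ B, P (A m) B * T (Fin.cons B (fun j => A (m.succAbove j))) := by
  simp only [slotAct, slotActAt, update_eq_cons_comp_cycleRange, hT]

variable {ε : Matrix α α ℂ}

lemma sum_skew_removeNth (hε : ∀ P Q, ε P Q = -ε Q P) (h : (Fin k → α) → ℂ)
    (A : Fin (k + 2) → α) :
    ∑ p : Fin (k + 2), ∑ q : Fin (k + 1), ε (A p) (A (p.succAbove q)) *
      h (fun m => A (p.succAbove (q.succAbove m))) = 0 := by
  have hswap := sum_removeNth_swap (fun P Q a => ε P Q * h a) A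
  simp only [fun (p : Fin (k + 2)) (q : Fin (k + 1)) => hε (A (p.succAbove q)) (A p),
    neg_mul, Finset.sum_neg_distrib] at hswap
  exact self_eq_neg.1 hswap

lemma sum_slotAct_eq_zero [Fintype α] [DecidableEq α] (hε : ∀ P Q, ε P Q = -ε Q P)
    {X : α → α → Matrix α α ℂ} {c : ℂ}
    (hX : ∀ P Q A B, X P Q A B =
      c * (ε P A * (1 : Matrix α α ℂ) Q B + ε Q A * (1 : Matrix α α ℂ) P B))
    {T : (Fin k → α) → ℂ} (hT : ∀ (t : Equiv.Perm (Fin k)) A, T (A ∘ t) = T A)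
    (A : Fin (k + 2) → α) :
    ∑ p : Fin (k + 2), ∑ q : Fin (k + 1), slotAct (X (A p) (A (p.succAbove q))) T
      (fun m => A (p.succAbove (q.succAbove m))) = 0 := by
  cases k with
  | zero => simp [slotAct]
  | succ k =>
    let G (P Q : α) (a : Fin (k + 1) → α) : ℂ :=
      ∑ m, ε Q (a m) * T (Fin.cons P (fun j => a (m.succAbove j)))
    have hslot (P Q : α) (a : Fin (k + 1) → α) : slotAct (X P Q) T a = c * (G Q P a + G P Q a) := by
      simp only [slotAct_of_symm _ hT, hX, G, ← Finset.sum_add_distrib, Finset.mul_sum]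
      refine Finset.sum_congr rfl fun m _ => ?_
      simp [mul_assoc, ← Finset.mul_sum, add_mul, Finset.sum_add_distrib, Matrix.one_apply]
    have hG : ∑ p : Fin (k + 3), ∑ q : Fin (k + 2), G (A p) (A (p.succAbove q))
        (fun m => A (p.succAbove (q.succAbove m))) = 0 :=
      Finset.sum_eq_zero fun p _ =>
        sum_skew_removeNth hε (fun a => T (Fin.cons (A p) a)) fun j => A (p.succAbove j)
    simp only [hslot, mul_add, Finset.sum_add_distrib, ← Finset.mul_sum]
    rw [← sum_removeNth_swap G, hG, mul_zero, add_zero]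

end SymmetricTensors

section Sufficiency

open SpinStructure

lemma eps_swap (P Q : Fin 2) : eps P Q = -eps Q P := by
  fin_cases P <;> fin_cases Q <;> simp [eps]

variable {M : Type*} [TopologicalSpace M] [ChartedSpace E4 M] [IsManifold (𝓡 4) ∞ M]
  [Bundle.RiemannianBundle (fun x : M => TangentSpace (𝓡 4) x)]
  [IsContMDiffRiemannianBundle (𝓡 4) ∞ E4 (fun x : M => TangentSpace (𝓡 4) x)]
  {S : SpinStructure M} {k n : ℕ}

lemma isCurvatureTensor_riemann (i : S.ι) {x : M} (hx : x ∈ S.U i) :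
    IsCurvatureTensor (riemann (S.e i) x) :=
  (S.isOrthonormalFrame i).isCurvatureTensor_riemann hx

lemma curvPair_eq (i : S.ι) {x : M} (hx : x ∈ S.U i) (T : SpinTensor k n)
    (A : Fin (k + 2) → Fin 2) (A' : Fin n → Fin 2) : curvPair i x T A A' =
      ∑ p : Fin (k + 2), ∑ q : Fin (k + 1),
        act (spinBlock (blockPlus (riemann (S.e i) x)) (A p) (A (p.succAbove q)))
          (spinBlock (blockMixed (riemann (S.e i) x)) (A p) (A (p.succAbove q))) T
          (fun m => A (p.succAbove (q.succAbove m))) A' := by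
  have hR := isCurvatureTensor_riemann i hx
  have hplus_curv (c b : Fin 4) : spinPlus (curvMatrix (S.e i) c b x) =
      -((1 / 2 : ℂ) • imQuat (sdPart (riemann (S.e i) x c b))) :=
    spinPlus_transpose (hR.skew_right c b)
  have hminus_curv (c b : Fin 4) : spinMinus (curvMatrix (S.e i) c b x) =
      -((1 / 2 : ℂ) • imQuat (asdPart (riemann (S.e i) x c b))) :=
    spinMinus_transpose (hR.skew_right c b)
  have hswap (c b : Fin 4) : riemann (S.e i) x c b = -riemann (S.e i) x b c :=
    funext₂ (hR.skew_left c b)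
  have hplus := sum_solderPair_smul_imQuat (F := fun c b => sdPart (riemann (S.e i) x c b))
    fun c b => (congrArg sdPart (hswap c b)).trans (sdPart_neg _)
  have hminus := sum_solderPair_smul_imQuat (F := fun c b => asdPart (riemann (S.e i) x c b))
    fun c b => (congrArg asdPart (hswap c b)).trans (asdPart_neg _)
  simp only [curvPair, curvAct, hplus_curv, hminus_curv, act, blockPlus, blockMixed, ← hplus,
    ← hminus, sum_slotAct, smul_slotAct, mul_add, Finset.sum_add_distrib]

lemma weylPlusVanishes_iff : S.WeylPlusVanishes ↔
    ∀ i, ∀ x ∈ S.U i, ∃ r : ℝ, blockPlus (riemann (S.e i) x) = r • 1 :=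
  forall_congr' fun i => forall₂_congr fun _ hx =>
    weylPlus_eq_zero_iff (isCurvatureTensor_riemann i hx)

lemma isEinstein_iff : S.IsEinstein ↔
    ∀ i, ∀ x ∈ S.U i, blockMixed (riemann (S.e i) x) = 0 :=
  forall_congr' fun i => forall₂_congr fun _ hx =>
    einstein_iff (isCurvatureTensor_riemann i hx)

lemma commutesOn_of_curvature (hW : k ≠ 0 → S.WeylPlusVanishes) (hE : n ≠ 0 → S.IsEinstein) :
    S.CommutesOn k n := by
  rw [commutesOn_iff]
  intro ψ i x hx
  funext A A'
  rw [curvPair_eq i hx]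
  simp only [act, Finset.sum_add_distrib, Pi.zero_apply]
  have hplus : ∑ p : Fin (k + 2), ∑ q : Fin (k + 1),
      slotAct (spinBlock (blockPlus (riemann (S.e i) x)) (A p) (A (p.succAbove q)))
        (fun a => ψ.comp i x a A') (fun m => A (p.succAbove (q.succAbove m))) = 0 := by
    rcases eq_or_ne k 0 with rfl | hk
    · simp [slotAct]
    · obtain ⟨r, hr⟩ := weylPlusVanishes_iff.1 (hW hk) i x hx
      rw [hr]
      exact sum_slotAct_eq_zero eps_swap (spinBlock_smul_one r)
        (fun t a => ψ.symm i x hx t 1 a A') A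
  have hminus (P Q : Fin 2) (a : Fin k → Fin 2) :
      slotAct (spinBlock (blockMixed (riemann (S.e i) x)) P Q) (ψ.comp i x a) A' = 0 := by
    rcases eq_or_ne n 0 with rfl | hn
    · simp [slotAct]
    · simp [isEinstein_iff.1 (hE hn) i x hx, spinBlock_zero, slotAct, slotActAt]
  simp [hplus, hminus]

end Sufficiency

section PureTensors

open scoped Matrix

variable {α R : Type*} [Fintype α] [CommRing R] {k : ℕ}

/-- The contraction of `T` with the `k`-th power of the covector `κ`. -/
def contract (κ : α → R) (T : (Fin k → α) → R) : R := ∑ a, (∏ m, κ (a m)) * T a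

lemma contract_add (κ : α → R) (T T' : (Fin k → α) → R) :
    contract κ (fun a => T a + T' a) = contract κ T + contract κ T' := by
  simp only [contract, mul_add, Finset.sum_add_distrib]

lemma contract_mul_const (κ : α → R) (T : (Fin k → α) → R) (c : R) :
    contract κ (fun a => T a * c) = contract κ T * c := by
  simp only [contract, Finset.sum_mul, mul_assoc]

lemma contract_const_mul (κ : α → R) (T : (Fin k → α) → R) (c : R) :
    contract κ (fun a => c * T a) = c * contract κ T := by
  simp only [contract, Finset.mul_sum, mul_left_comm c]

lemma contract_sum {ι : Type*} (s : Finset ι) (κ : α → R) (T : ι → (Fin k → α) → R) :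
    contract κ (fun a => ∑ i ∈ s, T i a) = ∑ i ∈ s, contract κ (T i) := by
  simp only [contract, Finset.mul_sum]
  exact Finset.sum_comm

lemma contract_prod (κ ξ : α → R) :
    contract κ (fun a : Fin k → α => ∏ m, ξ (a m)) = (κ ⬝ᵥ ξ) ^ k := by
  simp only [contract, ← Finset.prod_mul_distrib, dotProduct]
  exact (Fintype.sum_pow (fun P => κ P * ξ P) k).symm

lemma contract_succAbove (κ : α → R) (F : α → (Fin k → α) → R) (p : Fin (k + 1)) :
    contract κ (fun A => F (A p) fun m => A (p.succAbove m)) = ∑ P, κ P * contract κ (F P) := by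
  simp only [contract]
  rw [← (Fin.insertNthEquiv (fun _ => α) p).sum_comp, Fintype.sum_prod_type]
  refine Finset.sum_congr rfl fun P _ => ?_
  simp only [Fin.prod_univ_succAbove _ p, Fin.insertNthEquiv_apply, Fin.insertNth_apply_same,
    Fin.insertNth_apply_succAbove, mul_assoc, Finset.mul_sum]

lemma contract_sum_removeNth (κ : α → R) (F : α → α → (Fin k → α) → R) :
    contract κ (fun A => ∑ p : Fin (k + 2), ∑ q : Fin (k + 1),
        F (A p) (A (p.succAbove q)) fun m => A (p.succAbove (q.succAbove m))) =
      (k + 2) * (k + 1) * ∑ P, ∑ Q, κ P * κ Q * contract κ (F P Q) := by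
  have hterm (p : Fin (k + 2)) (q : Fin (k + 1)) :
      contract κ (fun A => F (A p) (A (p.succAbove q)) fun m => A (p.succAbove (q.succAbove m))) =
        ∑ P, ∑ Q, κ P * κ Q * contract κ (F P Q) := by
    rw [contract_succAbove κ (fun P a => F P (a q) fun m => a (q.succAbove m)) p]
    simp only [contract_succAbove κ (F _) q, Finset.mul_sum, mul_assoc]
  simp only [contract_sum, hterm, Finset.sum_const, Finset.card_univ, Fintype.card_fin,
    nsmul_eq_mul]
  push_cast
  ring

lemma contract_slotActAt_prod (X : Matrix α α R) (κ ξ : α → R) (m : Fin (k + 1)) :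
    contract κ (slotActAt m X fun a => ∏ j, ξ (a j)) = (κ ⬝ᵥ X *ᵥ ξ) * (κ ⬝ᵥ ξ) ^ k := by
  have hslot : (slotActAt m X fun a => ∏ j, ξ (a j)) =
      fun A => (X *ᵥ ξ) (A m) * ∏ j, ξ (A (m.succAbove j)) := by
    funext A
    simp only [slotActAt, Matrix.mulVec, dotProduct, Fin.prod_univ_succAbove _ m,
      Function.update_self, Function.update_of_ne (Fin.succAbove_ne m _), Finset.sum_mul, mul_assoc]
  rw [hslot, contract_succAbove κ (fun P a => (X *ᵥ ξ) P * ∏ j, ξ (a j)) m]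
  simp only [contract_const_mul, contract_prod, dotProduct, Finset.sum_mul, mul_assoc]

lemma contract_slotAct_prod (X : Matrix α α R) (κ ξ : α → R) :
    contract κ (slotAct X fun a : Fin k → α => ∏ m, ξ (a m)) =
      k * (κ ⬝ᵥ X *ᵥ ξ) * (κ ⬝ᵥ ξ) ^ (k - 1) := by
  cases k with
  | zero => simp [contract, slotAct]
  | succ k =>
    have hsum := contract_sum Finset.univ κ fun m : Fin (k + 1) =>
      slotActAt m X fun a => ∏ j, ξ (a j)
    simp only [contract_slotActAt_prod, Finset.sum_const, Finset.card_univ, Fintype.card_fin,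
      nsmul_eq_mul, ← mul_assoc] at hsum
    exact hsum

lemma sum_prod_mul_prod (P : Matrix α α R) (ξ : α → R) (A : Fin k → α) :
    ∑ B : Fin k → α, (∏ m, P (A m) (B m)) * ∏ m, ξ (B m) = ∏ m, (P *ᵥ ξ) (A m) := by
  simp only [← Finset.prod_mul_distrib, Matrix.mulVec, dotProduct, Finset.prod_univ_sum,
    Fintype.piFinset_univ]

end PureTensors

section PureSpinors

open scoped Matrix

variable {k n : ℕ}

/-- The tensor `ξ^k η^n`. -/
def pureTensor (k n : ℕ) (ξ η : Fin 2 → ℂ) : SpinTensor k n :=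
  fun A A' => (∏ m, ξ (A m)) * ∏ m, η (A' m)

lemma act_pureTensor (X Y : Matrix (Fin 2) (Fin 2) ℂ) (ξ η : Fin 2 → ℂ)
    (A : Fin k → Fin 2) (A' : Fin n → Fin 2) :
    act X Y (pureTensor k n ξ η) A A' =
      (∏ m, η (A' m)) * slotAct X (fun a => ∏ m, ξ (a m)) A +
        (∏ m, ξ (A m)) * slotAct Y (fun a' => ∏ m, η (a' m)) A' := by
  rw [← slotAct_const_mul, ← slotAct_const_mul]
  simp only [act, pureTensor, mul_comm]
  rfl

lemma contract_act_pureTensor (X Y : Matrix (Fin 2) (Fin 2) ℂ) (κ ξ κ' η : Fin 2 → ℂ) :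
    contract κ (fun a => contract κ' (act X Y (pureTensor k n ξ η) a)) =
      k * (κ ⬝ᵥ X *ᵥ ξ) * (κ ⬝ᵥ ξ) ^ (k - 1) * (κ' ⬝ᵥ η) ^ n +
        n * (κ' ⬝ᵥ Y *ᵥ η) * (κ ⬝ᵥ ξ) ^ k * (κ' ⬝ᵥ η) ^ (n - 1) := by
  have hact (a : Fin k → Fin 2) : act X Y (pureTensor k n ξ η) a = fun a' =>
      (∏ m, η (a' m)) * slotAct X (fun a => ∏ m, ξ (a m)) a +
        (∏ m, ξ (a m)) * slotAct Y (fun a' => ∏ m, η (a' m)) a' :=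
    funext fun a' => act_pureTensor X Y ξ η a a'
  simp only [hact, contract_add, contract_mul_const, contract_const_mul, contract_prod,
    contract_slotAct_prod]
  ring

/-- The contraction of `X ∈ S₊² ⊗ End S` with `κ`, `κ`, `κ'` and `η`. -/
def contractPair (X : Fin 2 → Fin 2 → Matrix (Fin 2) (Fin 2) ℂ) (κ κ' η : Fin 2 → ℂ) : ℂ :=
  ∑ P, ∑ Q, κ P * κ Q * (κ' ⬝ᵥ X P Q *ᵥ η)

/-- The isotropic vector of `ℂ³` which corresponds to the square of the spinor `(1, z)`. -/
def nullVec (z : ℂ) : Fin 3 → ℂ :=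
  ![2 * Complex.I * z, -(1 + z ^ 2), Complex.I * (z ^ 2 - 1)]

lemma contractPair_spinBlock (b : Matrix (Fin 3) (Fin 3) ℝ) (z z' s : ℂ) :
    contractPair (spinBlock b) ![1, z] ![1, z'] ![1 - s * z', s] =
      -(nullVec z ⬝ᵥ b.map (↑) *ᵥ (![Complex.I, -z', Complex.I * z'] - s • nullVec z')) := by
  simp [contractPair, spinBlock, dotProduct, Matrix.mulVec, Fin.sum_univ_three, soldering,
    Matrix.mul_apply, quat, eps, nullVec]
  ring

lemma nullVec_dotProduct_eq_zero {b : Matrix (Fin 3) (Fin 3) ℝ} {z z' : ℂ}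
    (h : contractPair (spinBlock b) ![1, z] ![1, z'] ![1 - 1 * z', 1] =
      contractPair (spinBlock b) ![1, z] ![1, z'] ![1 - 0 * z', 0]) :
    nullVec z ⬝ᵥ b.map (↑) *ᵥ nullVec z' = 0 := by
  simpa only [contractPair_spinBlock, Matrix.mulVec_sub, Matrix.mulVec_smul, dotProduct_sub,
    dotProduct_smul, one_smul, zero_smul, sub_zero, neg_inj, sub_eq_self] using h

lemma eq_smul_one_of_nullVec {b : Matrix (Fin 3) (Fin 3) ℝ} (hb : b.IsSymm)
    (h : ∀ z, nullVec z ⬝ᵥ b.map (↑) *ᵥ nullVec z = 0) : ∃ r : ℝ, b = r • 1 := by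
  have hsplit {u v : ℝ} (huv : (u : ℂ) + v * Complex.I = 0) : u = 0 ∧ v = 0 := by
    simpa [Complex.ext_iff] using huv
  have hform (z : ℂ) : nullVec z ⬝ᵥ b.map (↑) *ᵥ nullVec z =
      -4 * b 0 0 * z ^ 2 + b 1 1 * (1 + z ^ 2) ^ 2 - b 2 2 * (z ^ 2 - 1) ^ 2 -
        (4 * b 0 1 * z * (1 + z ^ 2) + 2 * b 1 2 * ((z ^ 2) ^ 2 - 1)) * Complex.I -
        4 * b 0 2 * z * (z ^ 2 - 1) := by
    simp only [nullVec, dotProduct, Matrix.mulVec, Fin.sum_univ_three, Matrix.map_apply,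
      hb.apply 0 1, hb.apply 0 2, hb.apply 1 2, Matrix.cons_val]
    linear_combination (4 * b 0 0 * z ^ 2 + b 2 2 * (z ^ 2 - 1) ^ 2 +
      4 * b 0 2 * z * (z ^ 2 - 1)) * Complex.I_sq
  obtain ⟨h12, h12'⟩ := hsplit (u := b 1 1 - b 2 2) (v := 2 * b 1 2) <| by
    push_cast
    linear_combination (hform 0).symm.trans (h 0)
  obtain ⟨h01, h01'⟩ := hsplit (u := b 1 1 - b 0 0) (v := -2 * b 0 1) <| by
    push_cast
    linear_combination (1 / 4) * (hform 1).symm.trans (h 1)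
  obtain ⟨-, h02'⟩ := hsplit (u := b 0 0 - b 2 2) (v := 2 * b 0 2) <| by
    have hI := (hform Complex.I).symm.trans (h Complex.I)
    rw [Complex.I_sq] at hI
    push_cast
    linear_combination (1 / 4) * hI
  refine ⟨b 0 0, ?_⟩
  ext i j
  fin_cases i <;> fin_cases j <;>
    simp [hb.apply 0 1, hb.apply 0 2, hb.apply 1 2] <;> linarith

lemma eq_zero_of_dotProduct_nullVec {c : Fin 3 → ℂ} (hc : ∀ z, c ⬝ᵥ nullVec z = 0) : c = 0 := by
  have hform (z : ℂ) : c ⬝ᵥ nullVec z =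
      c 0 * (2 * Complex.I * z) - c 1 * (1 + z ^ 2) + c 2 * (Complex.I * (z ^ 2 - 1)) := by
    simp only [nullVec, dotProduct, Fin.sum_univ_three, Matrix.cons_val]
    ring
  have h0 := (hform 0).symm.trans (hc 0)
  have h1 := (hform 1).symm.trans (hc 1)
  have h2 := (hform (-1)).symm.trans (hc (-1))
  have c1 : c 1 = 0 := by linear_combination (-1 / 4) * (h1 + h2)
  have c0 : c 0 * Complex.I = 0 := by linear_combination (1 / 4) * (h1 - h2)
  have c2 : c 2 * Complex.I = 0 := by linear_combination -h0 - c1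
  ext i
  fin_cases i
  exacts [(mul_eq_zero.1 c0).resolve_right Complex.I_ne_zero, c1,
    (mul_eq_zero.1 c2).resolve_right Complex.I_ne_zero]

lemma eq_zero_of_nullVec {b : Matrix (Fin 3) (Fin 3) ℝ}
    (h : ∀ z z', nullVec z ⬝ᵥ b.map (↑) *ᵥ nullVec z' = 0) : b = 0 := by
  have hrow (i : Fin 3) : (fun j => (b i j : ℂ)) = 0 :=
    eq_zero_of_dotProduct_nullVec fun z' => congrFun
      (eq_zero_of_dotProduct_nullVec fun z => (dotProduct_comm _ _).trans (h z z')) i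
  ext i j
  exact Complex.ofReal_eq_zero.1 (congrFun (hrow i) j)

lemma dotProduct_one_sub_mul (z s : ℂ) : (![1, z] : Fin 2 → ℂ) ⬝ᵥ ![1 - s * z, s] = 1 := by
  simp only [Matrix.dotProduct_of_isEmpty, Matrix.cons_dotProduct_cons]
  ring

lemma blocks_of_contractPair {b b' : Matrix (Fin 3) (Fin 3) ℝ} (hb : b.IsSymm)
    (h : ∀ κ ξ κ' η : Fin 2 → ℂ,
      k * contractPair (spinBlock b) κ κ ξ * (κ ⬝ᵥ ξ) ^ (k - 1) * (κ' ⬝ᵥ η) ^ n +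
        n * contractPair (spinBlock b') κ κ' η * (κ ⬝ᵥ ξ) ^ k * (κ' ⬝ᵥ η) ^ (n - 1) = 0) :
    (k ≠ 0 → ∃ r : ℝ, b = r • 1) ∧ (n ≠ 0 → b' = 0) := by
  have hnorm (z s z' s' : ℂ) :
      k * contractPair (spinBlock b) ![1, z] ![1, z] ![1 - s * z, s] +
        n * contractPair (spinBlock b') ![1, z] ![1, z'] ![1 - s' * z', s'] = 0 := by
    simpa only [dotProduct_one_sub_mul, one_pow, mul_one] using
      h ![1, z] ![1 - s * z, s] ![1, z'] ![1 - s' * z', s']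
  constructor
  · refine fun hk => eq_smul_one_of_nullVec hb fun z => nullVec_dotProduct_eq_zero ?_
    exact mul_left_cancel₀ (Nat.cast_ne_zero.2 hk)
      (add_right_cancel ((hnorm z 1 0 0).trans (hnorm z 0 0 0).symm))
  · refine fun hn => eq_zero_of_nullVec fun z z' => nullVec_dotProduct_eq_zero ?_
    exact mul_left_cancel₀ (Nat.cast_ne_zero.2 hn)
      (add_left_cancel ((hnorm z 0 z' 1).trans (hnorm z 0 z' 0).symm))

end PureSpinors

section TestSections

open SpinStructure
open scoped Matrix

variable {M : Type*} [TopologicalSpace M] [ChartedSpace E4 M] [IsManifold (𝓡 4) ∞ M]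
  [Bundle.RiemannianBundle (fun x : M => TangentSpace (𝓡 4) x)]
  {S : SpinStructure M} {k n : ℕ}

lemma tp_self (i : S.ι) {x : M} (hx : x ∈ S.U i) : S.tp i i x = 1 :=
  mul_eq_left.1 (S.cocycle_tp i i i x ⟨⟨hx, hx⟩, hx⟩)

lemma tm_self (i : S.ι) {x : M} (hx : x ∈ S.U i) : S.tm i i x = 1 :=
  mul_eq_left.1 (S.cocycle_tm i i i x ⟨⟨hx, hx⟩, hx⟩)

/-- The components in the trivialisation `j` of the section of `S₊^k ⊗ S₋^n` whose components in
the trivialisation `i` are `ξ^k η^n`. -/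
def pureComp (i : S.ι) (k n : ℕ) (ξ η : Fin 2 → ℂ) (j : S.ι) (y : M) : SpinTensor k n :=
  pureTensor k n ((S.tp j i y : Matrix (Fin 2) (Fin 2) ℂ) *ᵥ ξ)
    ((S.tm j i y : Matrix (Fin 2) (Fin 2) ℂ) *ᵥ η)

lemma smoothC_pureComp (i j : S.ι) (ξ η : Fin 2 → ℂ) (A : Fin k → Fin 2) (A' : Fin n → Fin 2) :
    SmoothC (S.U j ∩ S.U i) fun y => pureComp i k n ξ η j y A A' :=
  .mul (.prod fun m _ => .sum (s := Finset.univ) fun B _ =>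
    .mul (S.smooth_tp j i (A m) B) (.const (ξ B)))
    (.prod fun m _ => .sum (s := Finset.univ) fun B _ =>
      .mul (S.smooth_tm j i (A' m) B) (.const (η B)))

lemma pureComp_symm (i j : S.ι) (y : M) (ξ η : Fin 2 → ℂ) (s : Equiv.Perm (Fin k))
    (t : Equiv.Perm (Fin n)) (A : Fin k → Fin 2) (A' : Fin n → Fin 2) :
    pureComp i k n ξ η j y (A ∘ s) (A' ∘ t) = pureComp i k n ξ η j y A A' :=
  congrArg₂ (· * ·)
    (Equiv.prod_comp s fun m => ((S.tp j i y : Matrix (Fin 2) (Fin 2) ℂ) *ᵥ ξ) (A m))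
    (Equiv.prod_comp t fun m => ((S.tm j i y : Matrix (Fin 2) (Fin 2) ℂ) *ᵥ η) (A' m))

lemma pureComp_transition {i j l : S.ι} {y : M} (hy : y ∈ S.U j ∩ S.U l) (hyi : y ∈ S.U i)
    (ξ η : Fin 2 → ℂ) (A : Fin k → Fin 2) (A' : Fin n → Fin 2) :
    pureComp i k n ξ η j y A A' = ∑ B : Fin k → Fin 2, ∑ B' : Fin n → Fin 2,
      (∏ m, (S.tp j l y : Matrix (Fin 2) (Fin 2) ℂ) (A m) (B m)) *
        (∏ m, (S.tm j l y : Matrix (Fin 2) (Fin 2) ℂ) (A' m) (B' m)) *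
        pureComp i k n ξ η l y B B' := by
  have htp : (S.tp j i y : Matrix (Fin 2) (Fin 2) ℂ) = S.tp j l y * S.tp l i y :=
    congrArg Subtype.val (S.cocycle_tp j l i y ⟨hy, hyi⟩).symm
  have htm : (S.tm j i y : Matrix (Fin 2) (Fin 2) ℂ) = S.tm j l y * S.tm l i y :=
    congrArg Subtype.val (S.cocycle_tm j l i y ⟨hy, hyi⟩).symm
  simp only [pureComp, pureTensor, htp, htm, ← Matrix.mulVec_mulVec,
    ← sum_prod_mul_prod (S.tp j l y : Matrix (Fin 2) (Fin 2) ℂ),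
    ← sum_prod_mul_prod (S.tm j l y : Matrix (Fin 2) (Fin 2) ℂ), Finset.sum_mul_sum,
    mul_mul_mul_comm]

/-- The section of `S₊^k ⊗ S₋^n` with components `χ ξ^k η^n` in the trivialisation `i`, extended
by zero. -/
def testSection (i : S.ι) (k n : ℕ) (ξ η : Fin 2 → ℂ) (χ : M → ℝ)
    (hχ : ContMDiff (𝓡 4) 𝓘(ℝ, ℝ) ∞ χ) (hsupp : tsupport χ ⊆ S.U i) : SpinorField S k n where
  comp j y A A' := (χ y : ℂ) * pureComp i k n ξ η j y A A'
  smooth j A A' := by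
    intro y hy
    by_cases hyi : y ∈ S.U i
    · have hs := SmoothC.mul (.ofReal hχ.contMDiffOn) (smoothC_pureComp i j ξ η A A')
      exact (hs.contMDiffAt (((S.isOpen_U j).inter (S.isOpen_U i)).mem_nhds
        ⟨hy, hyi⟩)).contMDiffWithinAt
    · have hzero : (fun z => (χ z : ℂ) * pureComp i k n ξ η j z A A') =ᶠ[nhds y] fun _ => 0 := by
        filter_upwards [notMem_tsupport_iff_eventuallyEq.1 fun h => hyi (hsupp h)] with z hz
        simp [hz]
      exact (contMDiffAt_const.congr_of_eventuallyEq hzero).contMDiffWithinAt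
  symm j y _ s t A A' := congrArg ((χ y : ℂ) * ·) (pureComp_symm i j y ξ η s t A A')
  transition j l y hy A A' := by
    by_cases hχy : χ y = 0
    · simp [hχy]
    · rw [pureComp_transition hy (hsupp (subset_tsupport χ hχy))]
      simp only [Finset.mul_sum, mul_left_comm]

lemma exists_spinorField_eq [T2Space M] (i : S.ι) {x : M} (hx : x ∈ S.U i) (k n : ℕ)
    (ξ η : Fin 2 → ℂ) : ∃ ψ : SpinorField S k n, ψ.comp i x = pureTensor k n ξ η := by
  obtain ⟨χ, -, hχ⟩ := (SmoothBumpFunction.nhds_basis_tsupport (I := 𝓡 4) x).mem_iff.1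
    ((S.isOpen_U i).mem_nhds hx)
  refine ⟨testSection i k n ξ η χ χ.contMDiff hχ, ?_⟩
  funext A A'
  simp only [testSection, pureComp, tp_self i hx, tm_self i hx, OneMemClass.coe_one,
    Matrix.one_mulVec, χ.eq_one, Complex.ofReal_one, one_mul]

variable [IsContMDiffRiemannianBundle (𝓡 4) ∞ E4 (fun x : M => TangentSpace (𝓡 4) x)]

lemma contract_curvPair (i : S.ι) {x : M} (hx : x ∈ S.U i) (κ ξ κ' η : Fin 2 → ℂ) :
    contract κ (fun A => contract κ' (curvPair i x (pureTensor k n ξ η) A)) =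
      (k + 2) * (k + 1) *
        (k * contractPair (spinBlock (blockPlus (riemann (S.e i) x))) κ κ ξ *
            (κ ⬝ᵥ ξ) ^ (k - 1) * (κ' ⬝ᵥ η) ^ n +
          n * contractPair (spinBlock (blockMixed (riemann (S.e i) x))) κ κ' η *
            (κ ⬝ᵥ ξ) ^ k * (κ' ⬝ᵥ η) ^ (n - 1)) := by
  let F (P Q : Fin 2) (a : Fin k → Fin 2) : ℂ := contract κ'
    (act (spinBlock (blockPlus (riemann (S.e i) x)) P Q)
      (spinBlock (blockMixed (riemann (S.e i) x)) P Q) (pureTensor k n ξ η) a)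
  have hcurv (A : Fin (k + 2) → Fin 2) : contract κ' (curvPair i x (pureTensor k n ξ η) A) =
      ∑ p : Fin (k + 2), ∑ q : Fin (k + 1),
        F (A p) (A (p.succAbove q)) fun m => A (p.succAbove (q.succAbove m)) := by
    simp only [F, funext (curvPair_eq i hx (pureTensor k n ξ η) A), contract_sum]
  simp only [hcurv]
  rw [contract_sum_removeNth κ F]
  simp only [F, contract_act_pureTensor, contractPair, Fin.sum_univ_two]
  ring

lemma curvature_of_commutesOn [T2Space M] (h : S.CommutesOn k n) :
    (k ≠ 0 → S.WeylPlusVanishes) ∧ (n ≠ 0 → S.IsEinstein) := by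
  rw [commutesOn_iff] at h
  have hblocks (i : S.ι) {x : M} (hx : x ∈ S.U i) :
      (k ≠ 0 → ∃ r : ℝ, blockPlus (riemann (S.e i) x) = r • 1) ∧
        (n ≠ 0 → blockMixed (riemann (S.e i) x) = 0) := by
    refine blocks_of_contractPair (isCurvatureTensor_riemann i hx).isSymm_blockPlus
      fun κ ξ κ' η => ?_
    obtain ⟨ψ, hψ⟩ := exists_spinorField_eq i hx k n ξ η
    have hcontract := contract_curvPair (k := k) (n := n) i hx κ ξ κ' η
    rw [← hψ, h ψ i x hx] at hcontract
    simp only [contract, Pi.zero_apply, mul_zero, Finset.sum_const_zero] at hcontract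
    have hcard : ((k : ℂ) + 2) * (k + 1) ≠ 0 := by norm_cast
    exact (mul_eq_zero.1 hcontract.symm).resolve_left hcard
  exact ⟨fun hk => weylPlusVanishes_iff.2 fun i x hx => (hblocks i hx).1 hk,
    fun hn => isEinstein_iff.2 fun i x hx => (hblocks i hx).2 hn⟩

lemma commutesOn_iff_curvature [T2Space M] : S.CommutesOn k n ↔
    (k ≠ 0 → S.WeylPlusVanishes) ∧ (n ≠ 0 → S.IsEinstein) :=
  ⟨curvature_of_commutesOn, fun h => commutesOn_of_curvature h.1 h.2⟩

end TestSections

end SpinFour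

end

theorem proposition1 {M : Type*} [TopologicalSpace M] [T2Space M]
    [ChartedSpace SpinFour.E4 M] [IsManifold (𝓡 4) ∞ M]
    [Bundle.RiemannianBundle (fun x : M => TangentSpace (𝓡 4) x)]
    [IsContMDiffRiemannianBundle (𝓡 4) ∞ SpinFour.E4 (fun x : M => TangentSpace (𝓡 4) x)]
    (S : SpinFour.SpinStructure M) :
    ((∀ k n : ℕ, S.CommutesOn k n) ↔ S.WeylPlusVanishes ∧ S.IsEinstein) ∧
    (∀ k n : ℕ, 1 ≤ k → 1 ≤ n →
      (S.CommutesOn k n ↔ S.WeylPlusVanishes ∧ S.IsEinstein)) ∧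
    (∀ k : ℕ, 1 ≤ k →
      ((∀ ψ : SpinFour.SpinorField S k 0, ∀ i, ∀ x ∈ S.U i,
          SpinFour.SpinStructure.deltaOp i (SpinFour.SpinStructure.dOp i (ψ.comp i)) x = 0)
        ↔ S.WeylPlusVanishes)) ∧
    (∀ n : ℕ, 1 ≤ n → (S.CommutesOn 0 n ↔ S.IsEinstein)) := by
  have key (k n : ℕ) : S.CommutesOn k n ↔
      (k ≠ 0 → S.WeylPlusVanishes) ∧ (n ≠ 0 → S.IsEinstein) :=
    SpinFour.commutesOn_iff_curvature
  have hpair (k n : ℕ) (hk : 1 ≤ k) (hn : 1 ≤ n) :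
      S.CommutesOn k n ↔ S.WeylPlusVanishes ∧ S.IsEinstein := by
    simp [key, Nat.one_le_iff_ne_zero.1 hk, Nat.one_le_iff_ne_zero.1 hn]
  refine ⟨⟨fun h => (hpair 1 1 le_rfl le_rfl).1 (h 1 1),
    fun h k n => (key k n).2 ⟨fun _ => h.1, fun _ => h.2⟩⟩, hpair, fun k hk => ?_, fun n hn => ?_⟩
  · have hplus : S.CommutesOn k 0 ↔ S.WeylPlusVanishes := by
      simp [key, Nat.one_le_iff_ne_zero.1 hk]
    exact hplus
  · simp [key, Nat.one_le_iff_ne_zero.1 hn]
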